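/- For $p>0$, $p\ne1$, let $\mathcal V(p)=R(p)+S(p)$, where $$R(p)=\begin{cases}\dfrac{2\log p}{1+p^2}-\dfrac{2}{p\sqrt{1+p^2}}\,\mathrm{artanh}\dfrac{p}{\sqrt{1+p^2}},&p<1,\\[2mm]-\dfrac{2\log p}{p(1+p^2)}-\dfrac{2}{p\sqrt{1+p^2}}\,\mathrm{artanh}\dfrac{1}{\sqrt{1+p^2}},&p>1,\end{cases}$$ $$S(p)=\begin{cases}-\dfrac{2\log p}{1-p^2}+\dfrac{2}{p\sqrt{1-p^2}}\arctan\dfrac{p}{\sqrt{1-p^2}},&p<1,\\[2mm]\dfrac{2\log p}{p(p^2-1)}+\dfrac{2}{p\sqrt{p^2-1}}\arctan\dfrac{1}{\sqrt{p^2-1}},&p>1.\end{cases}$$ Put $K(x)=\mathcal V(e^{x/2})$ for $x\in\mathbb R$, and $\gamma=-2\left(2G+\tfrac{7\pi^2}{24}\right)$ with $G=\sum_{n\ge0}(-1)^n(2n+1)^{-2}$ Catalan's constant. For a function $g$ on $\mathbb R$ write $\widehat g(\xi)=\int_{\mathbb R}e^{-ix\xi}g(x)\,dx$ for complex $\xi$.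 Let $X_{A,B}$ be the space of real $f\in L^\infty_{\rm loc}(\mathbb R)$ with $\sup_{x<0}e^{-Ax}|f(x)|+\sup_{x>0}e^{-Bx}|f(x)|<\infty$ (essential suprema). Then $K(x)e^{3x/4}$ is integrable and $\gamma+\widehat K(3i/4)$ is a negative real number, written $-\nu$. For every $L\in\mathbb R$ there is a constant $C=C(L)>0$ with the following property. Let $$-\tfrac52<B<-\tfrac34<\tfrac12<A<1,\qquad f_0\in X_{A,B},\qquad 1\le p<\infty.$$ The problem $\partial_tf(t,x)=\gamma f(t,x)+\int_{\mathbb R}K(x-y)f(t,y)\,dy$ $(t>0)$, $f(0)=f_0$, has a solution $f\in C([0,\infty);L^p(\mathbb R))\cap C^1((0,\infty);L^p(\mathbb R))$, and for every such solution, every $t>0$ and every $\sigma$ with $\tfrac12<\sigma<-B$ (in particular every $\sigma>\tfrac12$ close to $\tfrac12$), $$\int_{-\infty}^Lf(t,x)e^{x/2}\,dx=\int_{\mathbb R}f(t,x)e^{x/2}\,dx+\frac1{2\pi}\int_{\operatorname{Im}\xi=\sigma}\widehat f_0(\xi)\,e^{(\gamma+\widehat K(\xi))t}\,\frac{e^{L(i\xi+\frac12)}}{i\xi+\frac12}\,d\xi,$$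 where all the integrals (including those defining $\widehat f_0$ and $\widehat K$ on the line $\operatorname{Im}\xi=\sigma$) are absolutely convergent and the total wave action $\int_{\mathbb R}f(t,x)e^{x/2}\,dx$ equals $\int_{\mathbb R}f_0(x)e^{x/2}\,dx$. Moreover $\int_{\mathbb R}|f_0(x)|e^{3x/4}\,dx<\infty$ and $$\left|\int_{\operatorname{Im}\xi=\sigma}\widehat f_0(\xi)\,e^{(\gamma+\widehat K(\xi))t}\,\frac{e^{L(i\xi+\frac12)}}{i\xi+\frac12}\,d\xi\right|\le C\,e^{-\nu t}\int_{\mathbb R}|f_0(x)|e^{3x/4}\,dx .$$ -/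

import Mathlib

open MeasureTheory Set
open scoped ENNReal

namespace RJ

noncomputable section

/-- The part `R` of the kernel of the linearised operator, in the variable `p > 0`. -/
def kernelR (p : ℝ) : ℝ :=
  if p < 1 then
    2 * Real.log p / (1 + p ^ 2)
      - 2 / (p * √(1 + p ^ 2)) * Real.artanh (p / √(1 + p ^ 2))
  else if 1 < p then
    -(2 * Real.log p / (p * (1 + p ^ 2))
      + 2 / (p * √(1 + p ^ 2)) * Real.artanh (1 / √(1 + p ^ 2)))
  else 0

/-- The part `S` of the kernel. The inverse function is the circular `arctan`: this is what gives
the kernel `𝒱 = R + S` its behaviour `-4 p² (log p - 2/3)` at `0` and `π / √(2 |p - 1|)` at `1`. -/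
def kernelS (p : ℝ) : ℝ :=
  if p < 1 then
    -(2 * Real.log p / (1 - p ^ 2))
      + 2 / (p * √(1 - p ^ 2)) * Real.arctan (p / √(1 - p ^ 2))
  else if 1 < p then
    2 * Real.log p / (p * (p ^ 2 - 1))
      + 2 / (p * √(p ^ 2 - 1)) * Real.arctan (1 / √(p ^ 2 - 1))
  else 0

/-- The kernel `𝒱` of the equation linearised around `p⁻²`. -/
def kernelV (p : ℝ) : ℝ := kernelR p + kernelS p

/-- The kernel in the variable `x = 2 log p`. -/
def K (x : ℝ) : ℝ := kernelV (Real.exp (x / 2))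

/-- Catalan's constant. -/
def catalanG : ℝ := ∑' n : ℕ, (-1 : ℝ) ^ n / (2 * (n : ℝ) + 1) ^ 2

/-- The explicit negative constant `γ_N = -(2 G + 7 π² / 24) ≈ -4.7106`. It is the closed form of
`-∬ min {1, p₂, p₃, p₄} (p₂ p₃ p₄)⁻² p₃ p₄ dp₃ dp₄` over `p₃, p₄ > 0`, `p₂² = p₃² + p₄² - 1 > 0`,
the coefficient of the unintegrated perturbation in the linearised collision operator. -/
def gammaN : ℝ := -(2 * catalanG + 7 * Real.pi ^ 2 / 24)

/-- `γ = 2 γ_N`. -/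
def gamma : ℝ := 2 * gammaN

/-- The Fourier transform `ĝ(ξ) = ∫ e^{-ixξ} g(x) dx` at complex `ξ`. -/
def hat (g : ℝ → ℝ) (ξ : ℂ) : ℂ :=
  ∫ x : ℝ, Complex.exp (-(Complex.I * (x : ℂ) * ξ)) * (g x : ℂ)

/-- `Ω(ξ) = γ + K̂(ξ)`. -/
def Omega (ξ : ℂ) : ℂ := (gamma : ℂ) + hat K ξ

/-- `‖g‖_{X_{A,B}} = sup_{x<0} e^{-Ax}|g(x)| + sup_{x>0} e^{-Bx}|g(x)|`, with essential suprema. -/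
def normX (A B : ℝ) (g : ℝ → ℝ) : ℝ≥0∞ :=
  eLpNorm (fun x => Real.exp (-A * x) * g x) ∞ (volume.restrict (Iio 0))
    + eLpNorm (fun x => Real.exp (-B * x) * g x) ∞ (volume.restrict (Ioi 0))

/-- `g ∈ X_{A,B}`: `g` is in `L^∞_loc(ℝ)` and has finite norm. -/
def MemX (A B : ℝ) (g : ℝ → ℝ) : Prop :=
  (∀ S : Set ℝ, IsCompact S → MemLp g ∞ (volume.restrict S)) ∧ normX A B g < ∞

/-- `f ∈ C([0,∞); L^p(ℝ)) ∩ C¹((0,∞); L^p(ℝ))` solves `∂f/∂t = γ f + K ∗ f` in `L^p(ℝ)` for all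
`t > 0`, with initial datum `f₀`. -/
structure IsSolution (p : ℝ≥0∞) [Fact (1 ≤ p)] (f₀ : ℝ → ℝ)
    (f : ℝ → Lp ℝ p (volume : Measure ℝ)) : Prop where
  continuousOn : ContinuousOn f (Ici 0)
  contDiffOn : ContDiffOn ℝ 1 f (Ioi 0)
  initial : f 0 =ᵐ[volume] f₀
  equation : ∀ t : ℝ, 0 < t →
    (deriv f t : Lp ℝ p (volume : Measure ℝ)) =ᵐ[volume] fun x => gamma * f t x + ∫ y : ℝ, K (x - y) * f t y

/-- The integrand `f̂₀(ξ) e^{(γ + K̂(ξ)) t} e^{L (iξ + 1/2)} / (iξ + 1/2)`. -/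
def contourIntegrand (f₀ : ℝ → ℝ) (t L : ℝ) (ξ : ℂ) : ℂ :=
  hat f₀ ξ * Complex.exp (Omega ξ * (t : ℂ))
    * (Complex.exp ((L : ℂ) * (Complex.I * ξ + 1 / 2)) / (Complex.I * ξ + 1 / 2))

end

end RJ

/-! Convolution with the integrable kernel `K` is bounded on every L^p with p finite, so the
equation is a linear ODE in L^p and its only solution is exp(t(γ + K∗)) f₀. Since e^{σx} =
e^{σ(x-y)} e^{σy}, multiplying by e^{σx} turns convolution with `K` into convolution with K e^{σ·},
which is integrable for -1 < σ < 5/2. Hence the solution times e^{σx} is the evolution of the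
weighted datum in L¹ and in L² (`exp_generator_weight`), and its transform on Im ξ = σ is f̂₀ e^{Ωt}
(`IsSolution.hat_eq`).

No contour is moved. For σ > 1/2 the weight e^{L(iξ+1/2)}/(iξ+1/2) is, up to sign and conjugation,
the transform of e^{(1/2-σ)x} on x > L. By Parseval the contour integral is -2π times the tail of
the wave action over x > L (`integral_contour`), and the representation formula is the splitting of
the total at L.

The total is conserved because Ω(i/2) = 0, that is, ∫ K e^{x/2} = -γ. This is an explicit
computation: geometric series for the logarithmic part of the kernel, dilogarithms for the arc part
(`integral_logPart`, `integral_arcPart`).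

The decay also comes from the tail, which is at most e^{-L/4} times the L¹ norm of f(t) with weight
e^{3x/4}. As `K` ≥ 0, that norm grows at rate at most γ + ∫ K e^{3x/4}. The symmetry K(-x) =
e^{3x/2} K(x) gives ∫ K e^{x} = ∫ K e^{x/2} = -γ, and 3/4 is the midpoint of 1/2 and 1, so strict
convexity makes the rate negative (`gamma_add_integral_K_neg`). -/

namespace RJ

/-! ### Parseval's identity for functions in `L¹ ∩ L²` -/

section Parseval

open FourierTransform SchwartzMap

/-- The `L²` Fourier transform of a function in `L¹ ∩ L²` is given by the Fourier integral. -/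
theorem fourier_toLp_ae_eq {g : ℝ → ℂ} (h₁ : Integrable g) (h₂ : MemLp g 2) :
    (𝓕 (h₂.toLp g) : Lp ℂ 2 (volume : Measure ℝ)) =ᵐ[volume] 𝓕 g := by
  have hcont : Continuous (𝓕 g) :=
    VectorFourier.fourierIntegral_continuous Real.continuous_fourierChar
      (by exact continuous_inner) h₁
  -- Against a smooth compactly supported φ both sides pair to ∫ g 𝓕φ: the L² transform as a
  -- tempered distribution, the Fourier integral by Fubini.
  refine ae_eq_of_integral_contDiff_smul_eq
    ((Lp.memLp (𝓕 (h₂.toLp g))).locallyIntegrable (by norm_num))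
    hcont.locallyIntegrable fun φ hφ hc => ?_
  have hφ' : ContDiff ℝ ((⊤ : ℕ∞) : WithTop ℕ∞) (fun x => (φ x : ℂ)) :=
    Complex.ofRealCLM.contDiff.comp hφ
  have hc' : HasCompactSupport (fun x => (φ x : ℂ)) :=
    hc.comp_left (g := fun y : ℝ => (y : ℂ)) (by simp)
  let ψ : 𝓢(ℝ, ℂ) := hc'.toSchwartzMap hφ'
  have hψ : ∀ x, ψ x = (φ x : ℂ) := fun x => rfl
  have e₁ := congrArg (fun T : 𝓢'(ℝ, ℂ) => T ψ)
    (Lp.fourier_toTemperedDistribution_eq (h₂.toLp g))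
  simp only [TemperedDistribution.fourier_apply, Lp.toTemperedDistribution_apply] at e₁
  have e₂ := VectorFourier.integral_fourierIntegral_smul_eq_flip (L := innerₗ ℝ)
    (μ := (volume : Measure ℝ)) (ν := (volume : Measure ℝ)) (f := g) (g := ψ)
    Real.continuous_fourierChar continuous_inner h₁ ψ.integrable
  simp only [flip_innerₗ] at e₂
  calc ∫ x, φ x • (𝓕 (h₂.toLp g) : Lp ℂ 2 (volume : Measure ℝ)) x
      = ∫ x, ψ x • (𝓕 (h₂.toLp g) : Lp ℂ 2 (volume : Measure ℝ)) x := by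
        simp [hψ]
    _ = ∫ x, (𝓕 ψ) x • (h₂.toLp g) x := e₁.symm
    _ = ∫ x, g x • 𝓕 (ψ : ℝ → ℂ) x := by
        refine integral_congr_ae ?_
        filter_upwards [h₂.coeFn_toLp] with x hx
        rw [hx, SchwartzMap.fourier_coe, smul_eq_mul, smul_eq_mul, mul_comm]
    _ = ∫ x, 𝓕 g x • ψ x := e₂.symm
    _ = ∫ x, φ x • 𝓕 g x := by
        simp [hψ, mul_comm]

theorem memLp_fourier {g : ℝ → ℂ} (h₁ : Integrable g) (h₂ : MemLp g 2) : MemLp (𝓕 g) 2 :=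
  (Lp.memLp (𝓕 (h₂.toLp g))).ae_eq (fourier_toLp_ae_eq h₁ h₂)

/-- Parseval's identity. -/
theorem integral_conj_fourier_mul_fourier {g h : ℝ → ℂ} (hg₁ : Integrable g) (hg₂ : MemLp g 2)
    (hh₁ : Integrable h) (hh₂ : MemLp h 2) :
    ∫ w, starRingEnd ℂ (𝓕 h w) * 𝓕 g w = ∫ x, starRingEnd ℂ (h x) * g x := by
  have e := Lp.inner_fourier_eq (hh₂.toLp h) (hg₂.toLp g)
  rw [L2.inner_def, L2.inner_def] at e
  refine Eq.trans (integral_congr_ae ?_) (e.trans (integral_congr_ae ?_))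
  · filter_upwards [fourier_toLp_ae_eq hg₁ hg₂, fourier_toLp_ae_eq hh₁ hh₂] with x h1 h2
    rw [h1, h2, RCLike.inner_apply, mul_comm]
  · filter_upwards [hg₂.coeFn_toLp, hh₂.coeFn_toLp] with x h1 h2
    rw [h1, h2, RCLike.inner_apply, mul_comm]

end Parseval

/-! ### The transform `hat` on horizontal lines and the contour integral -/

section Contour

open FourierTransform

/-- `𝓕` uses the phase e^{-2πixw}, hence the frequency u/(2π); the imaginary part σ becomes the
weight e^{σx}. -/
theorem hat_line_eq_fourier (f : ℝ → ℝ) (σ u : ℝ) :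
    hat f ((u : ℂ) + (σ : ℂ) * Complex.I)
      = 𝓕 (fun x : ℝ => ((f x * Real.exp (σ * x) : ℝ) : ℂ)) (u / (2 * Real.pi)) := by
  rw [Real.fourier_real_eq_integral_exp_smul, hat]
  refine integral_congr_ae (Filter.Eventually.of_forall fun x => ?_)
  have hpi : (Real.pi : ℂ) ≠ 0 := by exact_mod_cast Real.pi_ne_zero
  simp only [smul_eq_mul]
  push_cast
  rw [mul_comm ((f x : ℂ)), ← mul_assoc, ← Complex.exp_add]
  congr 2
  field_simp
  ring_nf
  simp only [Complex.I_sq]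
  ring

/-- The Fourier transform of a truncated exponential. -/
theorem fourier_indicator_exp {c : ℝ} (hc : c < 0) (L u : ℝ) :
    𝓕 (fun x : ℝ => (((Ioi L).indicator (fun x => Real.exp (c * x)) x : ℝ) : ℂ))
        (u / (2 * Real.pi))
      = -(Complex.exp ((c - u * Complex.I) * L) / (c - u * Complex.I)) := by
  have hpi : (Real.pi : ℂ) ≠ 0 := by exact_mod_cast Real.pi_ne_zero
  rw [Real.fourier_real_eq_integral_exp_smul, ← neg_div,
    ← integral_exp_mul_complex_Ioi (a := c - u * Complex.I) (by simpa using hc) L,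
    ← integral_indicator measurableSet_Ioi]
  refine integral_congr_ae (Filter.Eventually.of_forall fun x => ?_)
  by_cases hx : x ∈ Ioi L
  · simp only [indicator_of_mem hx, smul_eq_mul]
    push_cast
    rw [← Complex.exp_add]
    congr 1
    field_simp
    ring
  · simp [indicator_of_notMem hx]

theorem integrable_indicator_exp {c : ℝ} (hc : c < 0) (L : ℝ) :
    Integrable (fun x : ℝ => (((Ioi L).indicator (fun x => Real.exp (c * x)) x : ℝ) : ℂ)) :=
  ((integrable_indicator_iff measurableSet_Ioi).2 (integrableOn_exp_mul_Ioi hc L)).ofReal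

theorem memLp_two_indicator_exp {c : ℝ} (hc : c < 0) (L : ℝ) :
    MemLp (fun x : ℝ => (((Ioi L).indicator (fun x => Real.exp (c * x)) x : ℝ) : ℂ)) 2 := by
  rw [memLp_two_iff_integrable_sq_norm (integrable_indicator_exp hc L).aestronglyMeasurable]
  refine ((integrable_indicator_iff measurableSet_Ioi).2
    (integrableOn_exp_mul_Ioi (a := 2 * c) (by linarith) L)).congr
    (Filter.Eventually.of_forall fun x => ?_)
  by_cases hx : x ∈ Ioi L
  · simp only [indicator_of_mem hx, Complex.norm_real, Real.norm_eq_abs, sq_abs]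
    rw [← Real.exp_nat_mul]
    congr 1
    push_cast
    ring
  · simp [indicator_of_notMem hx]

/-- This recognises the contour weight as a Fourier transform. The exponent 1/2 - σ is chosen so
that its product with F e^{σx} is F e^{x/2}. -/
theorem conj_fourier_indicator_exp {σ : ℝ} (hσ : 1 / 2 < σ) (L u : ℝ) :
    starRingEnd ℂ (𝓕 (fun x : ℝ =>
        (((Ioi L).indicator (fun x => Real.exp ((1 / 2 - σ) * x)) x : ℝ) : ℂ)) (u / (2 * Real.pi)))
      = -(Complex.exp ((L : ℂ) * (Complex.I * (u + σ * Complex.I) + 1 / 2))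
          / (Complex.I * (u + σ * Complex.I) + 1 / 2)) := by
  have e : starRingEnd ℂ ((((1 / 2 - σ : ℝ) : ℂ) - u * Complex.I))
      = Complex.I * (u + σ * Complex.I) + 1 / 2 := by
    simp only [map_sub, map_mul, Complex.conj_ofReal, Complex.conj_I]
    push_cast
    ring_nf
    simp only [Complex.I_sq]
    ring
  rw [fourier_indicator_exp (by linarith), map_neg, map_div₀, ← Complex.exp_conj, map_mul, e,
    Complex.conj_ofReal, mul_comm (L : ℂ)]

variable {F : ℝ → ℝ} {σ : ℝ}

theorem memLp_hat_line (h₁ : Integrable fun x => F x * Real.exp (σ * x))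
    (h₂ : MemLp (fun x => F x * Real.exp (σ * x)) 2) :
    MemLp (fun w : ℝ => hat F (((2 * Real.pi * w : ℝ) : ℂ) + (σ : ℂ) * Complex.I)) 2 := by
  convert memLp_fourier h₁.ofReal h₂.ofReal using 2 with w
  rw [hat_line_eq_fourier, show 2 * Real.pi * w / (2 * Real.pi) = w by field_simp]
  rfl

/-- The weight decays only like 1/|u|, so it is square integrable but not integrable; this is why L²
information on the datum is needed besides L¹. -/
theorem memLp_contour_weight (hσ : 1 / 2 < σ) (L : ℝ) :
    MemLp (fun w : ℝ =>
      Complex.exp ((L : ℂ) * (Complex.I * (((2 * Real.pi * w : ℝ) : ℂ) + σ * Complex.I) + 1 / 2))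
        / (Complex.I * (((2 * Real.pi * w : ℝ) : ℂ) + σ * Complex.I) + 1 / 2)) 2 := by
  have hc : 1 / 2 - σ < 0 := by linarith
  have := (memLp_fourier (integrable_indicator_exp hc L) (memLp_two_indicator_exp hc L)).star.neg
  convert this using 2 with w
  have e := conj_fourier_indicator_exp hσ L (2 * Real.pi * w)
  rw [show 2 * Real.pi * w / (2 * Real.pi) = w by field_simp] at e
  rw [Pi.neg_apply, Pi.star_apply, Complex.star_def, e, neg_neg]

/-- The transform of a function in (weighted) `L¹ ∩ L²` is integrable against the weight of the
contour integral. -/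
theorem integrable_contour (hσ : 1 / 2 < σ) (L : ℝ)
    (h₁ : Integrable fun x => F x * Real.exp (σ * x))
    (h₂ : MemLp (fun x => F x * Real.exp (σ * x)) 2) :
    Integrable fun u : ℝ => hat F ((u : ℂ) + (σ : ℂ) * Complex.I) *
      (Complex.exp ((L : ℂ) * (Complex.I * (u + σ * Complex.I) + 1 / 2))
          / (Complex.I * (u + σ * Complex.I) + 1 / 2)) := by
  have := (memLp_hat_line h₁ h₂).integrable_mul (memLp_contour_weight hσ L)
  exact (integrable_comp_mul_left_iff (fun u : ℝ => hat F ((u : ℂ) + (σ : ℂ) * Complex.I) *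
      (Complex.exp ((L : ℂ) * (Complex.I * (u + σ * Complex.I) + 1 / 2))
          / (Complex.I * (u + σ * Complex.I) + 1 / 2))) (R := 2 * Real.pi) (by positivity)).1 this

/-- The contour integral computes the tail of the wave action. -/
theorem integral_contour (hσ : 1 / 2 < σ) (L : ℝ)
    (h₁ : Integrable fun x => F x * Real.exp (σ * x))
    (h₂ : MemLp (fun x => F x * Real.exp (σ * x)) 2) :
    ∫ u : ℝ, hat F ((u : ℂ) + (σ : ℂ) * Complex.I) *
      (Complex.exp ((L : ℂ) * (Complex.I * (u + σ * Complex.I) + 1 / 2))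
          / (Complex.I * (u + σ * Complex.I) + 1 / 2))
      = -(2 * Real.pi * ((∫ x in Ioi L, F x * Real.exp (x / 2) : ℝ) : ℂ)) := by
  have hc : 1 / 2 - σ < 0 := by linarith
  have P := integral_conj_fourier_mul_fourier
    (g := fun x : ℝ => ((F x * Real.exp (σ * x) : ℝ) : ℂ)) h₁.ofReal h₂.ofReal
    (integrable_indicator_exp hc L) (memLp_two_indicator_exp hc L)
  have e := Measure.integral_comp_div (fun w : ℝ => starRingEnd ℂ (𝓕 (fun x : ℝ =>
        (((Ioi L).indicator (fun x => Real.exp ((1 / 2 - σ) * x)) x : ℝ) : ℂ)) w)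
      * 𝓕 (fun x : ℝ => ((F x * Real.exp (σ * x) : ℝ) : ℂ)) w) (2 * Real.pi)
  rw [← integral_complex_ofReal, ← integral_indicator measurableSet_Ioi]
  trans -∫ u : ℝ, starRingEnd ℂ (𝓕 (fun x : ℝ =>
        (((Ioi L).indicator (fun x => Real.exp ((1 / 2 - σ) * x)) x : ℝ) : ℂ)) (u / (2 * Real.pi)))
      * 𝓕 (fun x : ℝ => ((F x * Real.exp (σ * x) : ℝ) : ℂ)) (u / (2 * Real.pi))
  · rw [← integral_neg]
    refine integral_congr_ae (Filter.Eventually.of_forall fun u => ?_)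
    simp only
    rw [conj_fourier_indicator_exp hσ, hat_line_eq_fourier]
    ring
  · rw [e, P, abs_of_pos (by positivity), Complex.real_smul,
      Complex.ofReal_mul, Complex.ofReal_ofNat]
    congr 2
    refine integral_congr_ae (Filter.Eventually.of_forall fun x => ?_)
    by_cases hx : x ∈ Ioi L
    · simp only [indicator_of_mem hx, Complex.conj_ofReal, ← Complex.ofReal_mul]
      rw [mul_left_comm, ← Real.exp_add]
      congr 3
      ring
    · simp [indicator_of_notMem hx]

end Contour

/-! ### Convolution with an integrable kernel as an operator on `L^p` -/

section Young

/-- Hölder applied to ab = a^{1/q} · (a^{1/r} b), with q conjugate to r. -/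
theorem lintegral_mul_rpow_le {a b : ℝ → ℝ≥0∞} (ha : Measurable a) (hb : Measurable b) {r : ℝ}
    (hr : 1 ≤ r) :
    (∫⁻ y, a y * b y) ^ r ≤ (∫⁻ y, a y) ^ (r - 1) * ∫⁻ y, a y * b y ^ r := by
  rcases hr.eq_or_lt with rfl | hr
  · simp
  have hpq := (Real.HolderConjugate.conjExponent hr).symm
  set q := r.conjExponent
  have hr0 : 0 < r := by linarith
  have hq0 : 0 < q := hpq.pos
  have hsum : 1 / q + 1 / r = 1 := by simpa using hpq.inv_add_inv_eq_one
  have h := ENNReal.lintegral_mul_le_Lp_mul_Lq volume hpq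
    (f := fun y => a y ^ (1 / q)) (g := fun y => a y ^ (1 / r) * b y)
    (by fun_prop) (by fun_prop)
  have e₁ : ∀ y, ((fun y => a y ^ (1 / q)) * fun y => a y ^ (1 / r) * b y) y = a y * b y := by
    intro y
    simp only [Pi.mul_apply]
    rw [← mul_assoc, ← ENNReal.rpow_add_of_nonneg _ _ (by positivity) (by positivity), hsum,
      ENNReal.rpow_one]
  have e₂ : ∀ y, (a y ^ (1 / q)) ^ q = a y := by
    intro y
    rw [← ENNReal.rpow_mul, one_div_mul_cancel hq0.ne', ENNReal.rpow_one]
  have e₃ : ∀ y, (a y ^ (1 / r) * b y) ^ r = a y * b y ^ r := by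
    intro y
    rw [ENNReal.mul_rpow_of_nonneg _ _ hr0.le, ← ENNReal.rpow_mul, one_div_mul_cancel hr0.ne',
      ENNReal.rpow_one]
  simp only [e₁, e₂, e₃] at h
  have hqr : 1 / q * r = r - 1 := by
    have : 1 / q = 1 - 1 / r := by linarith
    rw [this]
    field_simp
  calc (∫⁻ y, a y * b y) ^ r
      ≤ ((∫⁻ y, a y) ^ (1 / q) * (∫⁻ y, a y * b y ^ r) ^ (1 / r)) ^ r :=
        ENNReal.rpow_le_rpow h hr0.le
    _ = _ := by
        rw [ENNReal.mul_rpow_of_nonneg _ _ hr0.le, ← ENNReal.rpow_mul, ← ENNReal.rpow_mul, hqr,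
          one_div_mul_cancel hr0.ne', ENNReal.rpow_one]

theorem lintegral_lintegral_sub_mul {a b : ℝ → ℝ≥0∞} (ha : Measurable a) (hb : Measurable b) :
    ∫⁻ x, ∫⁻ y, a (x - y) * b y = (∫⁻ y, a y) * ∫⁻ y, b y := by
  rw [lintegral_lintegral_swap (by fun_prop)]
  have e : ∀ y, ∫⁻ x, a (x - y) * b y = (∫⁻ x, a x) * b y := fun y => by
    rw [lintegral_mul_const _ (by fun_prop), lintegral_sub_right_eq_self a y]
  simp_rw [e]
  rw [lintegral_const_mul _ hb]

/-- Young's inequality for the exponents `1`, `r`, `r`. -/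
theorem lintegral_young {a b : ℝ → ℝ≥0∞} (ha : Measurable a) (hb : Measurable b) {r : ℝ}
    (hr : 1 ≤ r) :
    ∫⁻ x, (∫⁻ y, a (x - y) * b y) ^ r ≤ (∫⁻ y, a y) ^ r * ∫⁻ y, b y ^ r := by
  calc ∫⁻ x, (∫⁻ y, a (x - y) * b y) ^ r
      ≤ ∫⁻ x, (∫⁻ y, a y) ^ (r - 1) * ∫⁻ y, a (x - y) * b y ^ r := by
        refine lintegral_mono fun x => ?_
        have h := lintegral_mul_rpow_le (a := fun y => a (x - y)) (by fun_prop) hb hr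
        rwa [lintegral_sub_left_eq_self a x] at h
    _ = (∫⁻ y, a y) ^ (r - 1) * ((∫⁻ y, a y) * ∫⁻ y, b y ^ r) := by
        rw [lintegral_const_mul _ (by fun_prop), lintegral_lintegral_sub_mul ha (by fun_prop)]
    _ = _ := by
        rw [← mul_assoc]
        nth_rw 2 [← ENNReal.rpow_one (∫⁻ y, a y)]
        rw [← ENNReal.rpow_add_of_nonneg _ _ (by linarith) zero_le_one, sub_add_cancel]

end Young

/-! ### Convolution as a bounded operator on L^p -/

section Operator

/-- The convolution `k ∗ f`. -/
noncomputable def conv (k f : ℝ → ℝ) (x : ℝ) : ℝ := ∫ y, k (x - y) * f y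

theorem conv_congr {k f g : ℝ → ℝ} (h : f =ᵐ[volume] g) : conv k f = conv k g := by
  funext x
  refine integral_congr_ae ?_
  filter_upwards [h] with y hy
  rw [hy]

variable {p : ℝ≥0∞} [Fact (1 ≤ p)] {k f : ℝ → ℝ}

theorem lintegral_conv_rpow_lt_top (hp : p ≠ ∞) (hk : Measurable k) (hki : Integrable k)
    (hf : Measurable f) (hfp : MemLp f p) :
    ∫⁻ x, (∫⁻ y, ‖k (x - y)‖ₑ * ‖f y‖ₑ) ^ p.toReal < ∞ := by
  have h1 : 1 ≤ p := Fact.out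
  have hr : 1 ≤ p.toReal := by
    simpa using ENNReal.toReal_mono hp h1
  refine (lintegral_young hk.enorm hf.enorm hr).trans_lt (ENNReal.mul_lt_top ?_ ?_)
  · exact ENNReal.rpow_lt_top_of_nonneg (by linarith) hki.2.ne
  · exact lintegral_rpow_enorm_lt_top_of_eLpNorm_lt_top (by positivity) hp hfp.2

theorem ae_integrable_conv (hp : p ≠ ∞) (hk : Measurable k) (hki : Integrable k)
    (hf : Measurable f) (hfp : MemLp f p) :
    ∀ᵐ x, Integrable fun y => k (x - y) * f y := by
  have h1 : 1 ≤ p := Fact.out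
  have hr : 1 ≤ p.toReal := by
    simpa using ENNReal.toReal_mono hp h1
  filter_upwards [ae_lt_top' (by fun_prop)
    (lintegral_conv_rpow_lt_top hp hk hki hf hfp).ne] with x hx
  refine ⟨by fun_prop, ?_⟩
  rw [HasFiniteIntegral]
  simp_rw [enorm_mul]
  exact (ENNReal.rpow_lt_top_iff_of_pos (by linarith)).1 hx

theorem stronglyMeasurable_conv (hk : Measurable k) (hf : Measurable f) :
    StronglyMeasurable (conv k f) := by
  have : Measurable fun z : ℝ × ℝ => k (z.1 - z.2) * f z.2 := by fun_prop
  exact this.stronglyMeasurable.integral_prod_right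

theorem eLpNorm_conv_le (hp : p ≠ ∞) (hk : Measurable k) (hf : Measurable f) :
    eLpNorm (conv k f) p volume ≤ eLpNorm k 1 volume * eLpNorm f p volume := by
  have h1 : 1 ≤ p := Fact.out
  have hr : 1 ≤ p.toReal := by
    simpa using ENNReal.toReal_mono hp h1
  have hp0 : p ≠ 0 := (zero_lt_one.trans_le h1).ne'
  rw [eLpNorm_eq_lintegral_rpow_enorm_toReal hp0 hp, eLpNorm_eq_lintegral_rpow_enorm_toReal hp0 hp,
    eLpNorm_one_eq_lintegral_enorm]
  have hr0 : 0 < p.toReal := by linarith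
  calc (∫⁻ x, ‖conv k f x‖ₑ ^ p.toReal) ^ (1 / p.toReal)
      ≤ ((∫⁻ y, ‖k y‖ₑ) ^ p.toReal * ∫⁻ y, ‖f y‖ₑ ^ p.toReal) ^ (1 / p.toReal) := by
        refine ENNReal.rpow_le_rpow ((lintegral_mono fun x => ?_).trans
          (lintegral_young hk.enorm hf.enorm hr)) (by positivity)
        refine ENNReal.rpow_le_rpow ?_ hr0.le
        refine (enorm_integral_le_lintegral_enorm _).trans_eq ?_
        simp_rw [enorm_mul]
    _ = _ := by
        rw [ENNReal.mul_rpow_of_nonneg _ _ (by positivity), ← ENNReal.rpow_mul,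
          mul_one_div_cancel hr0.ne', ENNReal.rpow_one]

theorem memLp_conv (hp : p ≠ ∞) (hk : Measurable k) (hki : Integrable k)
    (hf : Measurable f) (hfp : MemLp f p) : MemLp (conv k f) p :=
  ⟨(stronglyMeasurable_conv hk hf).aestronglyMeasurable,
    (eLpNorm_conv_le hp hk hf).trans_lt
      (ENNReal.mul_lt_top (memLp_one_iff_integrable.2 hki).2 hfp.2)⟩

/-- Convolution with the integrable kernel `k` on `L^p`. -/
noncomputable def convLp (hp : p ≠ ∞) (hk : Measurable k) (hki : Integrable k) :
    Lp ℝ p (volume : Measure ℝ) →L[ℝ] Lp ℝ p (volume : Measure ℝ) :=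
  LinearMap.mkContinuous
    { toFun := fun f => (memLp_conv hp hk hki (Lp.stronglyMeasurable f).measurable
        (Lp.memLp f)).toLp _
      map_add' := fun f g => by
        rw [← MemLp.toLp_add, MemLp.toLp_eq_toLp_iff, conv_congr (Lp.coeFn_add f g)]
        filter_upwards [ae_integrable_conv hp hk hki (Lp.stronglyMeasurable f).measurable
          (Lp.memLp f), ae_integrable_conv hp hk hki (Lp.stronglyMeasurable g).measurable
          (Lp.memLp g)] with x h1 h2
        simp only [conv, Pi.add_apply, mul_add]
        exact integral_add h1 h2
      map_smul' := fun c f => by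
        rw [RingHom.id_apply, ← MemLp.toLp_const_smul, MemLp.toLp_eq_toLp_iff,
          conv_congr (Lp.coeFn_smul c f)]
        refine Filter.Eventually.of_forall fun x => ?_
        simp only [conv, Pi.smul_apply, smul_eq_mul, mul_left_comm _ c]
        exact integral_const_mul c _ }
    (∫ x, |k x|) (fun f => by
      have h := eLpNorm_conv_le hp hk (Lp.stronglyMeasurable f).measurable
      have e : (∫ x, |k x|) = (eLpNorm k 1 volume).toReal := by
        rw [eLpNorm_one_eq_lintegral_enorm, ← integral_norm_eq_lintegral_enorm
          hki.aestronglyMeasurable]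
        rfl
      simp only [LinearMap.coe_mk, AddHom.coe_mk]
      rw [Lp.norm_toLp, Lp.norm_def, e, ← ENNReal.toReal_mul]
      exact ENNReal.toReal_mono (ENNReal.mul_lt_top (memLp_one_iff_integrable.2 hki).2
        (Lp.memLp f).2).ne h)

variable (hp : p ≠ ∞) (hk : Measurable k) (hki : Integrable k)

theorem convLp_ae_eq (F : Lp ℝ p (volume : Measure ℝ)) :
    convLp hp hk hki F =ᵐ[volume] conv k F :=
  (memLp_conv hp hk hki (Lp.stronglyMeasurable F).measurable (Lp.memLp F)).coeFn_toLp

theorem norm_convLp_le : ‖convLp (p := p) hp hk hki‖ ≤ ∫ x, |k x| :=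
  LinearMap.mkContinuous_norm_le _ (integral_nonneg fun _ => abs_nonneg _) _

end Operator

/-! ### The evolution generated by `γ + k ∗` -/

section Exponential

variable {E : Type*} [NormedAddCommGroup E] [NormedSpace ℝ E] [CompleteSpace E]

theorem hasSum_exp_smul_apply (T : E →L[ℝ] E) (t : ℝ) (x : E) :
    HasSum (fun n : ℕ => (t ^ n / n.factorial) • (T ^ n) x) (NormedSpace.exp (t • T) x) := by
  have h := (NormedSpace.exp_series_hasSum_exp' (𝕂 := ℝ) (t • T)).mapL
    (ContinuousLinearMap.apply ℝ E x)
  convert h using 2 with n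
  · simp [smul_pow, smul_smul, div_eq_inv_mul]
  · rfl

theorem norm_exp_smul_apply_le (T : E →L[ℝ] E) {t : ℝ} (ht : 0 ≤ t) (x : E) :
    ‖NormedSpace.exp (t • T) x‖ ≤ Real.exp (t * ‖T‖) * ‖x‖ := by
  have h := hasSum_exp_smul_apply T t x
  have hs := (NormedSpace.exp_series_hasSum_exp' (𝕂 := ℝ) (t * ‖T‖)).mul_right ‖x‖
  rw [← Real.exp_eq_exp_ℝ] at hs
  refine h.norm_le_of_bounded hs fun n => ?_
  rw [norm_smul, norm_div, norm_pow, Real.norm_of_nonneg ht, RCLike.norm_natCast, smul_eq_mul,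
    mul_pow, div_eq_inv_mul]
  have : ‖(T ^ n) x‖ ≤ ‖T‖ ^ n * ‖x‖ := by
    have := (T ^ n).le_opNorm x
    refine this.trans (mul_le_mul_of_nonneg_right ?_ (norm_nonneg x))
    rcases n with _ | n
    · rw [pow_zero, pow_zero]
      exact ContinuousLinearMap.norm_id_le
    · exact norm_pow_le' T n.succ_pos
  calc _ ≤ ((n.factorial : ℝ)⁻¹ * t ^ n) * (‖T‖ ^ n * ‖x‖) := by gcongr
    _ = _ := by ring

/-- The scalar is split off exactly because γ < 0: the bound e^{t‖γ + T‖} would lose its sign, and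
with it the decay. -/
theorem exp_smul_add_const (T : E →L[ℝ] E) (c t : ℝ) (x : E) :
    NormedSpace.exp (t • (c • ContinuousLinearMap.id ℝ E + T)) x
      = Real.exp (t * c) • NormedSpace.exp (t • T) x := by
  have e : t • (c • ContinuousLinearMap.id ℝ E + T)
      = algebraMap ℝ (E →L[ℝ] E) (t * c) + t • T := by
    rw [smul_add, smul_smul, Algebra.algebraMap_eq_smul_one]
    rfl
  have hQ : NormedAlgebra ℚ (E →L[ℝ] E) := NormedAlgebra.restrictScalars ℚ ℝ _
  rw [e, NormedSpace.exp_add_of_commute (Algebra.commutes _ _), ← NormedSpace.algebraMap_exp_comm,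
    ← Real.exp_eq_exp_ℝ, Algebra.algebraMap_eq_smul_one]
  simp

/-- A continuous functional that is an eigenvector of the transpose of `T`. -/
theorem map_exp_smul_apply (T : E →L[ℝ] E) (Φ : E →L[ℝ] ℂ) {z : ℂ} (hΦ : ∀ x, Φ (T x) = z * Φ x)
    (t : ℝ) (x : E) : Φ (NormedSpace.exp (t • T) x) = Complex.exp (z * t) * Φ x := by
  have h := (hasSum_exp_smul_apply T t x).mapL Φ
  have hz := (NormedSpace.exp_series_hasSum_exp' (𝕂 := ℂ) (z * t)).mul_right (Φ x)
  rw [← Complex.exp_eq_exp_ℂ] at hz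
  have e : ∀ n : ℕ, Φ ((T ^ n) x) = z ^ n * Φ x := by
    intro n
    induction n with
    | zero => simp
    | succ n ih => rw [pow_succ', mul_apply_eq_comp, hΦ, ih]; ring
  have e' : (fun n : ℕ => Φ ((t ^ n / n.factorial) • (T ^ n) x))
      = fun n : ℕ => ((n.factorial : ℂ)⁻¹ • (z * t) ^ n) * Φ x := by
    funext n
    rw [map_smul, e, Complex.real_smul, smul_eq_mul]
    push_cast
    ring
  rw [e'] at h
  exact h.unique hz

theorem hasDerivAt_exp_smul_apply (T : E →L[ℝ] E) (x : E) (s : ℝ) :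
    HasDerivAt (fun r : ℝ => NormedSpace.exp (r • T) x) (T (NormedSpace.exp (s • T) x)) s := by
  have h := (hasDerivAt_exp_smul_const' T s).clm_apply (hasDerivAt_const s x)
  simpa using h

/-- Uniqueness for `u' = T u` in the class `C([0,∞)) ∩ C¹((0,∞))`. -/
theorem eq_exp_smul_of_deriv_eq (T : E →L[ℝ] E) {u : ℝ → E} (hc : ContinuousOn u (Ici 0))
    (hd : DifferentiableOn ℝ u (Ioi 0)) (he : ∀ t, 0 < t → deriv u t = T (u t)) {t : ℝ}
    (ht : 0 ≤ t) : u t = NormedSpace.exp (t • T) (u 0) := by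
  have hexp := hasDerivAt_exp_smul_apply T (u 0)
  have hu : ∀ s ∈ Ico 0 t, HasDerivWithinAt u (T (u s)) (Ici s) s := by
    rintro s ⟨hs, -⟩
    rcases hs.eq_or_lt with rfl | hs
    -- At s = 0 the equation is not assumed; the right derivative there is the limit of the
    -- derivatives for s > 0, by continuity of u and T.
    · refine hasDerivWithinAt_Ici_of_tendsto_deriv hd
        ((hc 0 self_mem_Ici).mono Ioi_subset_Ici_self) self_mem_nhdsWithin ?_
      refine Filter.Tendsto.congr' (f₁ := fun s => T (u s)) ?_ ?_
      · filter_upwards [self_mem_nhdsWithin] with s hs using (he s hs).symm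
      · exact (T.continuous.tendsto _).comp
          ((hc 0 self_mem_Ici).mono Ioi_subset_Ici_self)
    · rw [← he s hs]
      exact ((hd s hs).differentiableAt (Ioi_mem_nhds hs)).hasDerivAt.hasDerivWithinAt
  refine ODE_solution_unique_of_mem_Icc_right (v := fun _ => T) (s := fun _ => univ) (K := ‖T‖₊)
    (a := 0) (b := t) (fun _ _ => T.lipschitz.lipschitzOnWith) (hc.mono Icc_subset_Ici_self) hu
    (fun _ _ => mem_univ _) (fun s _ => (hexp s).continuousAt.continuousWithinAt)
    (fun s _ => (hexp s).hasDerivWithinAt) (fun _ _ => mem_univ _) (by simp) ⟨ht, le_rfl⟩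

end Exponential

/-! ### Compatibility of the evolutions under exponential weights -/

section Weighted

variable {p q : ℝ≥0∞} [Fact (1 ≤ p)] [Fact (1 ≤ q)]

/-- The relation `G = w F` is closed under simultaneous convergence in `L^p` and `L^q`. -/
theorem ae_eq_mul_of_tendsto {w : ℝ → ℝ} {F : ℕ → Lp ℝ p (volume : Measure ℝ)}
    {G : ℕ → Lp ℝ q (volume : Measure ℝ)} {F' : Lp ℝ p (volume : Measure ℝ)}
    {G' : Lp ℝ q (volume : Measure ℝ)} (hF : Filter.Tendsto F Filter.atTop (nhds F'))
    (hG : Filter.Tendsto G Filter.atTop (nhds G'))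
    (h : ∀ n, G n =ᵐ[volume] fun x => F n x * w x) : G' =ᵐ[volume] fun x => F' x * w x := by
  -- Norm convergence gives pointwise convergence only along subsequences, so the one for G is
  -- extracted from the one already chosen for F.
  obtain ⟨m, hm, hFm⟩ := (tendstoInMeasure_of_tendsto_Lp hF).exists_seq_tendsto_ae
  obtain ⟨l, hl, hGl⟩ := (tendstoInMeasure_of_tendsto_Lp
    (hG.comp hm.tendsto_atTop)).exists_seq_tendsto_ae
  filter_upwards [hFm, hGl, ae_all_iff.2 h] with x h₁ h₂ h₃
  refine tendsto_nhds_unique h₂ ?_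
  simp only [Function.comp_apply, h₃]
  exact (h₁.comp hl.tendsto_atTop).mul_const _

/-- The generator `γ + k ∗` on `L^p`. -/
noncomputable def generator {k : ℝ → ℝ} (hp : p ≠ ∞) (hk : Measurable k) (hki : Integrable k) :
    Lp ℝ p (volume : Measure ℝ) →L[ℝ] Lp ℝ p (volume : Measure ℝ) :=
  gamma • ContinuousLinearMap.id ℝ _ + convLp hp hk hki

theorem generator_ae_eq {k : ℝ → ℝ} (hp : p ≠ ∞) (hk : Measurable k) (hki : Integrable k)
    (F : Lp ℝ p (volume : Measure ℝ)) :
    generator hp hk hki F =ᵐ[volume] fun x => gamma * F x + ∫ y, k (x - y) * F y := by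
  have e : generator hp hk hki F = gamma • F + convLp hp hk hki F := rfl
  rw [e]
  filter_upwards [Lp.coeFn_add (gamma • F) (convLp hp hk hki F), Lp.coeFn_smul gamma F,
    convLp_ae_eq hp hk hki F] with x h₁ h₂ h₃
  rw [h₁, Pi.add_apply, h₂, h₃]
  rfl

variable {k : ℝ → ℝ} {σ : ℝ} (hp : p ≠ ∞) (hq : q ≠ ∞) (hk : Measurable k) (hki : Integrable k)
  (hw : Measurable fun x => k x * Real.exp (σ * x))
  (hwi : Integrable fun x => k x * Real.exp (σ * x))

/-- Multiplicativity of the weight, e^{σx} = e^{σ(x-y)} e^{σy}, moves it inside the convolution. -/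
theorem generator_weight {F : Lp ℝ p (volume : Measure ℝ)} {G : Lp ℝ q (volume : Measure ℝ)}
    (h : G =ᵐ[volume] fun x => F x * Real.exp (σ * x)) :
    generator hq hw hwi G =ᵐ[volume] fun x => generator hp hk hki F x * Real.exp (σ * x) := by
  filter_upwards [generator_ae_eq hq hw hwi G, generator_ae_eq hp hk hki F, h] with x h₁ h₂ h₃
  rw [h₁, h₂, h₃, add_mul, mul_assoc, ← integral_mul_const]
  congr 1
  refine integral_congr_ae ?_
  filter_upwards [h] with y hy
  rw [hy, show σ * x = σ * (x - y) + σ * y by ring, Real.exp_add]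
  ring

/-- The evolutions on `L^p` and on `L^q` with an exponential weight agree. -/
theorem exp_generator_weight {F : Lp ℝ p (volume : Measure ℝ)} {G : Lp ℝ q (volume : Measure ℝ)}
    (h : G =ᵐ[volume] fun x => F x * Real.exp (σ * x)) (t : ℝ) :
    NormedSpace.exp (t • generator hq hw hwi) G =ᵐ[volume]
      fun x => NormedSpace.exp (t • generator hp hk hki) F x * Real.exp (σ * x) := by
  -- Multiplication by e^{σx} is not a bounded map from L^p to L^q, so the relation is carried
  -- through powers and partial sums of the exponential series and then to the limit.
  have hpow : ∀ n : ℕ, (generator hq hw hwi ^ n) G =ᵐ[volume]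
      fun x => (generator hp hk hki ^ n) F x * Real.exp (σ * x) := by
    intro n
    induction n with
    | zero => simpa using h
    | succ n ih =>
      rw [pow_succ', pow_succ']
      exact generator_weight hp hq hk hki hw hwi ih
  refine ae_eq_mul_of_tendsto (hasSum_exp_smul_apply _ t F).tendsto_sum_nat
    (hasSum_exp_smul_apply _ t G).tendsto_sum_nat fun n => ?_
  induction n with
  | zero =>
    simp only [Finset.range_zero, Finset.sum_empty]
    filter_upwards [Lp.coeFn_zero ℝ p volume, Lp.coeFn_zero ℝ q volume] with x h₁ h₂
    rw [h₁, h₂]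
    simp
  | succ n ih =>
    rw [Finset.sum_range_succ, Finset.sum_range_succ]
    filter_upwards [ih, hpow n, Lp.coeFn_add (∑ i ∈ Finset.range n,
        (t ^ i / i.factorial) • (generator hp hk hki ^ i) F)
        ((t ^ n / n.factorial) • (generator hp hk hki ^ n) F),
      Lp.coeFn_add (∑ i ∈ Finset.range n, (t ^ i / i.factorial) • (generator hq hw hwi ^ i) G)
        ((t ^ n / n.factorial) • (generator hq hw hwi ^ n) G),
      Lp.coeFn_smul (t ^ n / (n.factorial : ℝ)) ((generator hp hk hki ^ n) F),
      Lp.coeFn_smul (t ^ n / (n.factorial : ℝ)) ((generator hq hw hwi ^ n) G)]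
      with x h₁ h₂ h₃ h₄ h₅ h₆
    rw [h₃, h₄, Pi.add_apply, Pi.add_apply, h₅, h₆, h₁, Pi.smul_apply, Pi.smul_apply, h₂]
    simp only [smul_eq_mul]
    ring

end Weighted

/-! ### Solutions of the linear equation -/

section FourierL1

theorem norm_exp_neg_I_mul (x u : ℝ) : ‖Complex.exp (-(Complex.I * x * u))‖ = 1 := by
  rw [show -(Complex.I * x * u) = ((-(x * u) : ℝ) : ℂ) * Complex.I by push_cast; ring]
  exact Complex.norm_exp_ofReal_mul_I _

theorem integrable_exp_neg_I_mul {g : ℝ → ℝ} (hg : Integrable g) (u : ℝ) :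
    Integrable fun x : ℝ => Complex.exp (-(Complex.I * x * u)) * (g x : ℂ) := by
  refine hg.ofReal.bdd_mul (c := 1) (by fun_prop) (Filter.Eventually.of_forall fun x => ?_)
  exact (norm_exp_neg_I_mul x u).le

/-- The Fourier transform at the real frequency `u` as a functional on `L¹`. -/
noncomputable def fourierL1 (u : ℝ) : Lp ℝ 1 (volume : Measure ℝ) →L[ℝ] ℂ :=
  LinearMap.mkContinuous
    { toFun := fun G => ∫ x : ℝ, Complex.exp (-(Complex.I * x * u)) * (G x : ℂ)
      map_add' := fun F G => by
        rw [← integral_add (integrable_exp_neg_I_mul (L1.integrable_coeFn F) u)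
          (integrable_exp_neg_I_mul (L1.integrable_coeFn G) u)]
        refine integral_congr_ae ?_
        filter_upwards [Lp.coeFn_add F G] with x hx
        rw [hx, Pi.add_apply]
        push_cast
        ring
      map_smul' := fun c G => by
        rw [RingHom.id_apply, ← integral_smul]
        refine integral_congr_ae ?_
        filter_upwards [Lp.coeFn_smul c G] with x hx
        rw [hx, Pi.smul_apply, Complex.real_smul, smul_eq_mul]
        push_cast
        ring }
    1 (fun G => by
      rw [one_mul, L1.norm_eq_integral_norm]
      refine (norm_integral_le_integral_norm _).trans_eq ?_
      refine integral_congr_ae (Filter.Eventually.of_forall fun x => ?_)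
      simp only [norm_mul, norm_exp_neg_I_mul, one_mul, Complex.norm_real])

theorem fourierL1_apply (u : ℝ) (G : Lp ℝ 1 (volume : Measure ℝ)) :
    fourierL1 u G = ∫ x : ℝ, Complex.exp (-(Complex.I * x * u)) * (G x : ℂ) := rfl

variable {k : ℝ → ℝ} (hk : Measurable k) (hki : Integrable k)

/-- The convolution theorem: `fourierL1 u` is an eigenvector of the transpose of convolution, as
`map_exp_smul_apply` requires. -/
theorem fourierL1_convLp (u : ℝ) (G : Lp ℝ 1 (volume : Measure ℝ)) :
    fourierL1 u (convLp ENNReal.one_ne_top hk hki G)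
      = (∫ x : ℝ, Complex.exp (-(Complex.I * x * u)) * (k x : ℂ)) * fourierL1 u G := by
  have h := integral_convolution (ContinuousLinearMap.mul ℝ ℂ)
    (integrable_exp_neg_I_mul (L1.integrable_coeFn G) u) (integrable_exp_neg_I_mul hki u)
  rw [fourierL1_apply, fourierL1_apply, mul_comm]
  rw [ContinuousLinearMap.mul_apply'] at h
  rw [← h]
  refine integral_congr_ae ?_
  filter_upwards [convLp_ae_eq ENNReal.one_ne_top hk hki G] with x hx
  rw [hx, convolution, conv, ← integral_complex_ofReal, ← integral_const_mul]
  refine integral_congr_ae (Filter.Eventually.of_forall fun y => ?_)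
  simp only [ContinuousLinearMap.mul_apply']
  rw [show -(Complex.I * x * u)
    = -(Complex.I * y * u) + -(Complex.I * ((x - y : ℝ) : ℂ) * u) by push_cast; ring,
    Complex.exp_add]
  push_cast
  ring

theorem fourierL1_exp_generator (u t : ℝ) (G : Lp ℝ 1 (volume : Measure ℝ)) :
    fourierL1 u (NormedSpace.exp (t • generator ENNReal.one_ne_top hk hki) G)
      = Complex.exp ((gamma + ∫ x : ℝ, Complex.exp (-(Complex.I * x * u)) * (k x : ℂ)) * t)
        * fourierL1 u G := by
  refine map_exp_smul_apply _ _ (fun F => ?_) t G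
  have e : generator ENNReal.one_ne_top hk hki F
    = gamma • F + convLp ENNReal.one_ne_top hk hki F := rfl
  rw [e, map_add, map_smul, fourierL1_convLp, Complex.real_smul]
  ring

theorem hat_line (f : ℝ → ℝ) (σ u : ℝ) :
    hat f ((u : ℂ) + (σ : ℂ) * Complex.I)
      = ∫ x : ℝ, Complex.exp (-(Complex.I * x * u)) * ((f x * Real.exp (σ * x) : ℝ) : ℂ) := by
  refine integral_congr_ae (Filter.Eventually.of_forall fun x => ?_)
  simp only
  rw [show -(Complex.I * x * (u + σ * Complex.I)) = -(Complex.I * x * u) + (σ * x : ℝ) by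
    push_cast; ring_nf; simp only [Complex.I_sq]; ring, Complex.exp_add]
  push_cast
  ring

end FourierL1

/-! ### Representation, transform and growth of solutions -/

section Solutions

variable {p : ℝ≥0∞} [Fact (1 ≤ p)] {f₀ : ℝ → ℝ} {f : ℝ → Lp ℝ p (volume : Measure ℝ)}
  (hp : p ≠ ∞) (hK : Measurable K) (hKi : Integrable K)

theorem IsSolution.eq_exp (h : IsSolution p f₀ f) {t : ℝ} (ht : 0 ≤ t) :
    f t = NormedSpace.exp (t • generator hp hK hKi) (f 0) := by
  refine eq_exp_smul_of_deriv_eq _ h.continuousOn (h.contDiffOn.differentiableOn one_ne_zero)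
    (fun s hs => ?_) ht
  exact Lp.ext ((h.equation s hs).trans (generator_ae_eq hp hK hKi (f s)).symm)

include hp hK hKi in
theorem exists_isSolution (h₀ : MemLp f₀ p) :
    ∃ f : ℝ → Lp ℝ p (volume : Measure ℝ), IsSolution p f₀ f := by
  have hd := hasDerivAt_exp_smul_apply (generator hp hK hKi) (h₀.toLp f₀)
  have hdiff : Differentiable ℝ
      fun r : ℝ => NormedSpace.exp (r • generator hp hK hKi) (h₀.toLp f₀) :=
    fun s => (hd s).differentiableAt
  have hderiv : deriv (fun r : ℝ => NormedSpace.exp (r • generator hp hK hKi) (h₀.toLp f₀))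
      = fun s => generator hp hK hKi (NormedSpace.exp (s • generator hp hK hKi) (h₀.toLp f₀)) :=
    funext fun s => (hd s).deriv
  refine ⟨fun t => NormedSpace.exp (t • generator hp hK hKi) (h₀.toLp f₀),
    hdiff.continuous.continuousOn, ?_, ?_, fun t _ => ?_⟩
  · refine (contDiff_one_iff_deriv.2 ⟨hdiff, ?_⟩).contDiffOn
    rw [hderiv]
    exact (generator hp hK hKi).continuous.comp hdiff.continuous
  · simpa using h₀.coeFn_toLp
  · rw [hderiv]
    exact generator_ae_eq hp hK hKi _

variable {σ : ℝ} (hw : Measurable fun x => K x * Real.exp (σ * x))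
  (hwi : Integrable fun x => K x * Real.exp (σ * x))

-- The bridge from the L^p solution to weighted spaces: weighted integrability of f(t) is not
-- assumed but inherited from the datum.
include hp hK hKi in
theorem IsSolution.weighted_ae_eq {q : ℝ≥0∞} [Fact (1 ≤ q)] (hq : q ≠ ∞) (h : IsSolution p f₀ f)
    (h₀ : MemLp (fun x => f₀ x * Real.exp (σ * x)) q) {t : ℝ} (ht : 0 ≤ t) :
    NormedSpace.exp (t • generator hq hw hwi) (h₀.toLp _) =ᵐ[volume]
      fun x => f t x * Real.exp (σ * x) := by
  rw [h.eq_exp hp hK hKi ht]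
  refine exp_generator_weight hp hq hK hKi hw hwi ?_ t
  filter_upwards [h₀.coeFn_toLp, h.initial] with x h₁ h₂
  rw [h₁, h₂]

include hp hK hKi hw hwi in
theorem IsSolution.memLp_weighted {q : ℝ≥0∞} [Fact (1 ≤ q)] (hq : q ≠ ∞) (h : IsSolution p f₀ f)
    (h₀ : MemLp (fun x => f₀ x * Real.exp (σ * x)) q) {t : ℝ} (ht : 0 ≤ t) :
    MemLp (fun x => f t x * Real.exp (σ * x)) q :=
  (Lp.memLp _).ae_eq (h.weighted_ae_eq hp hK hKi hw hwi hq h₀ ht)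

include hp hK hKi hw hwi in
theorem IsSolution.hat_eq (h : IsSolution p f₀ f)
    (h₀ : Integrable (fun x => f₀ x * Real.exp (σ * x))) {t : ℝ} (ht : 0 ≤ t) (u : ℝ) :
    hat (f t) ((u : ℂ) + (σ : ℂ) * Complex.I)
      = hat f₀ ((u : ℂ) + (σ : ℂ) * Complex.I)
        * Complex.exp (Omega ((u : ℂ) + (σ : ℂ) * Complex.I) * t) := by
  have h₁ := memLp_one_iff_integrable.2 h₀
  have e := fourierL1_exp_generator hw hwi u t (h₁.toLp _)
  rw [Omega, hat_line, hat_line, hat_line, mul_comm]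
  convert e using 1
  · rw [fourierL1_apply]
    refine integral_congr_ae ?_
    filter_upwards [h.weighted_ae_eq hp hK hKi hw hwi ENNReal.one_ne_top h₁ ht] with x hx
    rw [hx]
  · congr 1
    rw [fourierL1_apply]
    refine integral_congr_ae ?_
    filter_upwards [h₁.coeFn_toLp] with x hx
    rw [hx]

include hp hK hKi hw hwi in
/-- Growth of the weighted `L¹` norm of a solution. -/
theorem IsSolution.integral_abs_le (h : IsSolution p f₀ f)
    (h₀ : Integrable (fun x => f₀ x * Real.exp (σ * x))) {t : ℝ} (ht : 0 ≤ t) :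
    ∫ x, |f t x| * Real.exp (σ * x)
      ≤ Real.exp ((gamma + ∫ x, |K x * Real.exp (σ * x)|) * t)
        * ∫ x, |f₀ x| * Real.exp (σ * x) := by
  have h₁ := memLp_one_iff_integrable.2 h₀
  have hn : ‖NormedSpace.exp (t • generator ENNReal.one_ne_top hw hwi) (h₁.toLp _)‖
      ≤ Real.exp (t * gamma) * (Real.exp (t * ∫ x, |K x * Real.exp (σ * x)|) * ‖h₁.toLp _‖) := by
    rw [generator, exp_smul_add_const, norm_smul, Real.norm_of_nonneg (Real.exp_pos _).le]
    gcongr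
    refine (norm_exp_smul_apply_le _ ht _).trans ?_
    gcongr
    exact norm_convLp_le _ _ _
  rw [L1.norm_eq_integral_norm, L1.norm_eq_integral_norm, ← mul_assoc, ← Real.exp_add] at hn
  convert hn using 1
  · refine integral_congr_ae ?_
    filter_upwards [h.weighted_ae_eq hp hK hKi hw hwi ENNReal.one_ne_top h₁ ht] with x hx
    rw [hx, norm_mul, Real.norm_eq_abs, Real.norm_of_nonneg (Real.exp_pos _).le]
  · congr 1
    · congr 1
      ring
    · refine integral_congr_ae ?_
      filter_upwards [h₁.coeFn_toLp] with x hx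
      rw [hx, norm_mul, Real.norm_eq_abs, Real.norm_of_nonneg (Real.exp_pos _).le]

end Solutions

/-! ### The spaces `X_{A,B}` -/

section SpaceX

theorem integrable_exp_neg_mul_abs {c : ℝ} (hc : 0 < c) :
    Integrable fun x : ℝ => Real.exp (-c * |x|) := by
  have h₁ : IntegrableOn (fun x : ℝ => Real.exp (-c * |x|)) (Iic 0) :=
    (integrableOn_exp_mul_Iic hc 0).congr_fun
      (fun x hx => by simp only [abs_of_nonpos (mem_Iic.1 hx)]; ring_nf) measurableSet_Iic
  have h₂ : IntegrableOn (fun x : ℝ => Real.exp (-c * |x|)) (Ioi 0) :=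
    (integrableOn_exp_mul_Ioi (neg_lt_zero.2 hc) 0).congr_fun
      (fun x hx => by simp only [abs_of_pos (mem_Ioi.1 hx)]) measurableSet_Ioi
  have := h₁.union h₂
  rwa [Iic_union_Ioi, integrableOn_univ] at this

theorem memLp_exp_neg_mul_abs {c : ℝ} (hc : 0 < c) {q : ℝ≥0∞} (hq0 : q ≠ 0) (hq : q ≠ ∞) :
    MemLp (fun x : ℝ => Real.exp (-c * |x|)) q := by
  rw [← integrable_norm_rpow_iff (by fun_prop) hq0 hq]
  have hq' : 0 < q.toReal := ENNReal.toReal_pos hq0 hq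
  refine (integrable_exp_neg_mul_abs (mul_pos hc hq')).congr
    (Filter.Eventually.of_forall fun x => ?_)
  simp only
  rw [Real.norm_of_nonneg (Real.exp_pos _).le, ← Real.exp_mul]
  ring_nf

variable {A B : ℝ} {g : ℝ → ℝ}

theorem MemX.aestronglyMeasurable (h : MemX A B g) : AEStronglyMeasurable g := by
  have e : (⋃ n : ℕ, Icc (-(n : ℝ)) n) = univ := by
    refine eq_univ_of_forall fun x => mem_iUnion.2 ?_
    obtain ⟨n, hn⟩ := exists_nat_ge |x|
    exact ⟨n, abs_le.1 hn⟩
  rw [← Measure.restrict_univ (μ := (volume : Measure ℝ)), ← e, aestronglyMeasurable_iUnion_iff]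
  exact fun n => (h.1 _ isCompact_Icc).1

theorem ae_le_of_eLpNorm_top_lt {s : Set ℝ} (hs : MeasurableSet s) {φ : ℝ → ℝ}
    (h : eLpNorm φ ∞ (volume.restrict s) < ∞) : ∃ M : ℝ, ∀ᵐ x, x ∈ s → |φ x| ≤ M := by
  rw [eLpNorm_exponent_top] at h
  refine ⟨(eLpNormEssSup φ (volume.restrict s)).toReal, ?_⟩
  have := ae_le_eLpNormEssSup (f := φ) (μ := volume.restrict s)
  rw [ae_restrict_iff' hs] at this
  filter_upwards [this] with x hx hxs
  have := ENNReal.toReal_mono h.ne (hx hxs)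
  simpa using this

/-- The weighted function is O(e^{(A+σ)x}) on the left and O(e^{(B+σ)x}) on the right; the two
conditions on σ make both decay, and c is the smaller rate. -/
theorem MemX.ae_le (h : MemX A B g) {σ : ℝ} (hA : -A < σ) (hB : σ < -B) :
    ∃ M c : ℝ, 0 < c ∧ ∀ᵐ x, |g x * Real.exp (σ * x)| ≤ M * Real.exp (-c * |x|) := by
  have hn := h.2
  rw [normX, ENNReal.add_lt_top] at hn
  obtain ⟨M₁, h₁⟩ := ae_le_of_eLpNorm_top_lt measurableSet_Iio hn.1
  obtain ⟨M₂, h₂⟩ := ae_le_of_eLpNorm_top_lt measurableSet_Ioi hn.2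
  have key : ∀ {M D x : ℝ}, |Real.exp (-D * x) * g x| ≤ M →
      min (A + σ) (-B - σ) * |x| ≤ -(D + σ) * x →
      |g x * Real.exp (σ * x)|
        ≤ max (max M₁ M₂) M * Real.exp (-min (A + σ) (-B - σ) * |x|) := by
    intro M D x hM hx
    have e : g x * Real.exp (σ * x)
        = (Real.exp (-D * x) * g x) * Real.exp ((D + σ) * x) := by
      rw [mul_right_comm, mul_comm, ← Real.exp_add]
      ring_nf
    rw [e, abs_mul, abs_of_pos (Real.exp_pos _)]
    have hM0 : 0 ≤ M := (abs_nonneg _).trans hM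
    exact mul_le_mul (hM.trans (le_max_right _ _)) (Real.exp_le_exp.2 (by linarith))
      (Real.exp_pos _).le (hM0.trans (le_max_right _ _))
  refine ⟨max M₁ M₂, min (A + σ) (-B - σ), lt_min (by linarith) (by linarith), ?_⟩
  filter_upwards [h₁, h₂, Measure.ae_ne volume (0 : ℝ)] with x hx₁ hx₂ hx₀
  rcases lt_or_gt_of_ne hx₀ with hx | hx
  · have := key (hx₁ hx) (by
      rw [abs_of_neg hx]
      nlinarith [min_le_left (A + σ) (-B - σ)])
    rwa [max_eq_left (le_max_left M₁ M₂)] at this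
  · have := key (hx₂ hx) (by
      rw [abs_of_pos hx]
      nlinarith [min_le_right (A + σ) (-B - σ)])
    rwa [max_eq_left (le_max_right M₁ M₂)] at this

theorem MemX.memLp_weighted (h : MemX A B g) {σ : ℝ} (hA : -A < σ) (hB : σ < -B) {q : ℝ≥0∞}
    (hq0 : q ≠ 0) (hq : q ≠ ∞) : MemLp (fun x => g x * Real.exp (σ * x)) q := by
  obtain ⟨M, c, hc, hM⟩ := h.ae_le hA hB
  refine ((memLp_exp_neg_mul_abs hc hq0 hq).const_mul M).mono
    (h.aestronglyMeasurable.mul (by fun_prop)) ?_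
  filter_upwards [hM] with x hx
  exact hx.trans (le_abs_self _)

end SpaceX

/-! ### The kernel: closed form, symmetry, positivity and integrability -/

section Kernel

theorem artanh_div_sqrt_one_add_sq (p : ℝ) : Real.artanh (p / √(1 + p ^ 2)) = Real.arsinh p := by
  rw [← Real.artanh_tanh (Real.arsinh p), Real.tanh_eq_sinh_div_cosh, Real.sinh_arsinh,
    Real.cosh_arsinh]

/-- The two logarithmic terms merge over 1 - p⁴, and the inverse functions become arcsin and arsinh.
In this form both summands are visibly nonnegative. -/
theorem kernelV_of_lt_one {p : ℝ} (h₀ : 0 < p) (h₁ : p < 1) :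
    kernelV p = -(4 * p ^ 2 * Real.log p) / (1 - p ^ 4)
      + 2 / p * (Real.arcsin p / √(1 - p ^ 2) - Real.arsinh p / √(1 + p ^ 2)) := by
  have h2 : 0 < 1 - p ^ 2 := by nlinarith
  have h4 : 1 - p ^ 4 ≠ 0 := by nlinarith
  rw [kernelV, kernelR, kernelS, if_pos h₁, if_pos h₁, artanh_div_sqrt_one_add_sq,
    Real.arcsin_eq_arctan ⟨by linarith, h₁⟩]
  have hs : √(1 - p ^ 2) ≠ 0 := (Real.sqrt_pos.2 h2).ne'
  have hs' : √(1 + p ^ 2) ≠ 0 := (Real.sqrt_pos.2 (by positivity)).ne'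
  have e : (1 - p ^ 4) = (1 - p ^ 2) * (1 + p ^ 2) := by ring
  rw [e]
  have h2' : (1 - p ^ 2) ≠ 0 := h2.ne'
  field_simp
  ring

theorem kernelV_of_one_lt {p : ℝ} (h : 1 < p) : kernelV p = kernelV p⁻¹ / p ^ 3 := by
  have h₀ : 0 < p := by linarith
  have h₁ : ¬ p < 1 := by linarith
  have h₂ : p⁻¹ < 1 := inv_lt_one_of_one_lt₀ h
  rw [kernelV, kernelR, kernelS, if_neg h₁, if_neg h₁, if_pos h, if_pos h, kernelV, kernelR,
    kernelS, if_pos h₂, if_pos h₂]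
  have e₁ : √(1 + p⁻¹ ^ 2) = √(1 + p ^ 2) / p := by
    rw [show 1 + p⁻¹ ^ 2 = (1 + p ^ 2) / p ^ 2 by field_simp; ring, Real.sqrt_div (by positivity),
      Real.sqrt_sq h₀.le]
  have e₂ : √(1 - p⁻¹ ^ 2) = √(p ^ 2 - 1) / p := by
    rw [show 1 - p⁻¹ ^ 2 = (p ^ 2 - 1) / p ^ 2 by field_simp, Real.sqrt_div (by nlinarith),
      Real.sqrt_sq h₀.le]
  have h2 : 0 < p ^ 2 - 1 := by nlinarith
  have hs : √(p ^ 2 - 1) ≠ 0 := (Real.sqrt_pos.2 h2).ne'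
  have hs' : √(1 + p ^ 2) ≠ 0 := (Real.sqrt_pos.2 (by positivity)).ne'
  rw [e₁, e₂, Real.log_inv, show p⁻¹ / (√(1 + p ^ 2) / p) = 1 / √(1 + p ^ 2) by field_simp,
    show p⁻¹ / (√(p ^ 2 - 1) / p) = 1 / √(p ^ 2 - 1) by field_simp]
  have h3 : 1 - p⁻¹ ^ 2 = (p ^ 2 - 1) / p ^ 2 := by field_simp
  have h4 : 1 + p⁻¹ ^ 2 = (1 + p ^ 2) / p ^ 2 := by field_simp; ring
  rw [h3, h4]
  have h2' : p ^ 2 - 1 ≠ 0 := h2.ne'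
  field_simp
  ring

/-- The inversion p ↦ 1/p in the variable x. It exchanges the weights σ and 3/2 - σ, with centre
3/4. -/
theorem K_neg (x : ℝ) : K (-x) = Real.exp (3 * x / 2) * K x := by
  have key : ∀ x : ℝ, 0 < x → K (-x) = Real.exp (3 * x / 2) * K x := by
    intro x hx
    rw [K, K, kernelV_of_one_lt (p := Real.exp (x / 2)) (Real.one_lt_exp_iff.2 (by linarith)),
      ← Real.exp_neg, ← Real.exp_nat_mul, neg_div, show ((3 : ℕ) : ℝ) * (x / 2) = 3 * x / 2 by push_cast; ring,
      mul_div_cancel₀ _ (Real.exp_pos _).ne']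
  rcases lt_trichotomy x 0 with hx | rfl | hx
  · have := key (-x) (by linarith)
    rw [neg_neg] at this
    rw [this, ← mul_assoc, ← Real.exp_add, show 3 * x / 2 + 3 * -x / 2 = 0 by ring, Real.exp_zero,
      one_mul]
  · simp
  · exact key x hx

theorem self_le_arcsin {p : ℝ} (h₀ : 0 ≤ p) (h₁ : p ≤ 1) : p ≤ Real.arcsin p := by
  have h := Real.sin_le (Real.arcsin_nonneg.2 h₀)
  rwa [Real.sin_arcsin (by linarith) h₁] at h

theorem arsinh_le_self {p : ℝ} (h₀ : 0 ≤ p) : Real.arsinh p ≤ p := by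
  have h := Real.self_le_sinh_iff.2 (Real.arsinh_nonneg_iff.2 h₀)
  rwa [Real.sinh_arsinh] at h

theorem div_sqrt_le_arsinh {p : ℝ} (h₀ : 0 < p) : p / √(1 + p ^ 2) ≤ Real.arsinh p := by
  obtain ⟨c, hc, h⟩ := exists_hasDerivAt_eq_slope Real.arsinh (fun x => (√(1 + x ^ 2))⁻¹) h₀
    Real.continuous_arsinh.continuousOn (fun x _ => Real.hasDerivAt_arsinh x)
  rw [Real.arsinh_zero, sub_zero, sub_zero, eq_div_iff h₀.ne'] at h
  rw [← h, div_eq_inv_mul]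
  have : 0 < 1 + c ^ 2 := by positivity
  gcongr
  exacts [hc.1.le, hc.2.le]

/-- The half-angle formula for `arcsin`. -/
theorem arcsin_eq_two_mul_arctan {p : ℝ} (h₀ : 0 ≤ p) (h₁ : p ≤ 1) :
    Real.arcsin p = 2 * Real.arctan (p / (1 + √(1 - p ^ 2))) := by
  have hs : 0 ≤ √(1 - p ^ 2) := Real.sqrt_nonneg _
  have hss : √(1 - p ^ 2) ^ 2 = 1 - p ^ 2 := Real.sq_sqrt (by nlinarith)
  set s := √(1 - p ^ 2)
  have ht : p / (1 + s) ≤ 1 := by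
    rw [div_le_one (by positivity)]
    linarith
  have ht0 : 0 ≤ p / (1 + s) := by positivity
  refine Real.arcsin_eq_of_sin_eq ?_ ⟨?_, ?_⟩
  · rw [Real.sin_two_mul, Real.sin_arctan, Real.cos_arctan]
    have h1 : 0 < 1 + (p / (1 + s)) ^ 2 := by positivity
    have e : 2 * (p / (1 + s) / √(1 + (p / (1 + s)) ^ 2)) * (1 / √(1 + (p / (1 + s)) ^ 2))
        = 2 * (p / (1 + s)) / (1 + (p / (1 + s)) ^ 2) := by
      rw [show ∀ a b : ℝ, 2 * (a / b) * (1 / b) = 2 * a / b ^ 2 by intro a b; ring,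
        Real.sq_sqrt h1.le]
    rw [e, div_eq_iff h1.ne']
    have h1s : 1 + s ≠ 0 := by positivity
    field_simp
    nlinarith
  · have := Real.arctan_nonneg.2 ht0
    linarith [Real.pi_pos]
  · have := Real.arctan_mono ht
    rw [Real.arctan_one] at this
    linarith

/-- From arctan u ≤ u in the half-angle formula. The cubic coefficient is crude; only the order at 0
matters. -/
theorem arcsin_le {p : ℝ} (h₀ : 0 ≤ p) (h₁ : p ≤ 1) : Real.arcsin p ≤ p + p ^ 3 := by
  rw [arcsin_eq_two_mul_arctan h₀ h₁]
  have hs : 0 ≤ √(1 - p ^ 2) := Real.sqrt_nonneg _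
  have hss : √(1 - p ^ 2) ^ 2 = 1 - p ^ 2 := Real.sq_sqrt (by nlinarith)
  have hs1 : √(1 - p ^ 2) ≤ 1 := by rw [Real.sqrt_le_one]; nlinarith
  set s := √(1 - p ^ 2)
  have h := Real.le_tan (Real.arctan_nonneg.2 (show 0 ≤ p / (1 + s) by positivity))
    (Real.arctan_lt_pi_div_two _)
  rw [Real.tan_arctan] at h
  have h' : p / (1 + s) ≤ (p + p ^ 3) / 2 := by
    rw [div_le_div_iff₀ (by positivity) two_pos]
    have : 2 ≤ (1 + p ^ 2) * (1 + s) := by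
      have : p ^ 2 = 1 - s ^ 2 := by linarith
      rw [this]
      nlinarith [mul_nonneg hs (sub_nonneg.2 hs1), mul_nonneg (mul_nonneg hs hs) (sub_nonneg.2 hs1)]
    nlinarith
  linarith

/-- The number p separates the two quotients. -/
theorem arcsin_sub_arsinh_nonneg {p : ℝ} (h₀ : 0 < p) (h₁ : p < 1) :
    0 ≤ Real.arcsin p / √(1 - p ^ 2) - Real.arsinh p / √(1 + p ^ 2) := by
  have hs : 0 < √(1 - p ^ 2) := Real.sqrt_pos.2 (by nlinarith)
  have hs1 : √(1 - p ^ 2) ≤ 1 := by rw [Real.sqrt_le_one]; nlinarith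
  have hs2 : 1 ≤ √(1 + p ^ 2) := by rw [Real.one_le_sqrt]; nlinarith
  have a : p ≤ Real.arcsin p / √(1 - p ^ 2) := by
    rw [le_div_iff₀ hs]
    nlinarith [self_le_arcsin h₀.le h₁.le]
  have b : Real.arsinh p / √(1 + p ^ 2) ≤ p := by
    rw [div_le_iff₀ (by linarith)]
    nlinarith [arsinh_le_self h₀.le]
  linarith

/-- The linear terms cancel, leaving order p³ at 0; after the factor 2/p this is p² = e^x. The three
units of the constant come from `arcsin_le`, the lower bound p - p³ for the arsinh quotient, and p(1
- √(1-p²)) ≤ p³. -/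
theorem arcsin_sub_arsinh_le {p : ℝ} (h₀ : 0 < p) (h₁ : p < 1) :
    Real.arcsin p / √(1 - p ^ 2) - Real.arsinh p / √(1 + p ^ 2)
      ≤ 3 * p ^ 3 / √(1 - p ^ 2) := by
  have hs : 0 < √(1 - p ^ 2) := Real.sqrt_pos.2 (by nlinarith)
  have hss : √(1 - p ^ 2) ^ 2 = 1 - p ^ 2 := Real.sq_sqrt (by nlinarith)
  have hs1 : √(1 - p ^ 2) ≤ 1 := by rw [Real.sqrt_le_one]; nlinarith
  have hr : 0 < √(1 + p ^ 2) := Real.sqrt_pos.2 (by positivity)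
  have hrr : √(1 + p ^ 2) ^ 2 = 1 + p ^ 2 := Real.sq_sqrt (by positivity)
  have b : p - p ^ 3 ≤ Real.arsinh p / √(1 + p ^ 2) := by
    have := div_le_div_of_nonneg_right (div_sqrt_le_arsinh h₀) hr.le
    refine le_trans ?_ this
    rw [div_div, ← sq, hrr, le_div_iff₀ (by positivity)]
    nlinarith [pow_pos h₀ 5]
  set s := √(1 - p ^ 2)
  have a : Real.arcsin p / s ≤ (p + p ^ 3) / s :=
    div_le_div_of_nonneg_right (arcsin_le h₀.le h₁.le) hs.le
  have c : (p + p ^ 3) / s - (p - p ^ 3) ≤ 3 * p ^ 3 / s := by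
    rw [sub_le_iff_le_add, div_add' _ _ _ hs.ne', div_le_div_iff_of_pos_right hs]
    have h3 : 0 < p ^ 3 := by positivity
    have : p * (1 - s) ≤ p ^ 3 := by
      have : 1 - s ≤ p ^ 2 := by nlinarith
      nlinarith
    nlinarith
  linarith

theorem kernelV_pos {p : ℝ} (h₀ : 0 < p) (h₁ : p < 1) : 0 < kernelV p := by
  rw [kernelV_of_lt_one h₀ h₁]
  have h4 : p ^ 4 < 1 := pow_lt_one₀ h₀.le h₁ (by norm_num)
  have hl : Real.log p < 0 := Real.log_neg h₀ h₁
  have a : 0 < -(4 * p ^ 2 * Real.log p) / (1 - p ^ 4) := by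
    refine div_pos ?_ (by linarith)
    have : 0 < 4 * p ^ 2 := by positivity
    nlinarith
  have b := mul_nonneg (show 0 ≤ 2 / p by positivity) (arcsin_sub_arsinh_nonneg h₀ h₁)
  linarith

theorem K_pos {x : ℝ} (hx : x ≠ 0) : 0 < K x := by
  have key : ∀ x : ℝ, x < 0 → 0 < K x := fun x hx =>
    kernelV_pos (Real.exp_pos _) (Real.exp_lt_one_iff.2 (by linarith))
  rcases lt_or_gt_of_ne hx with hx | hx
  · exact key x hx
  · have := key (-x) (by linarith)
    rw [K_neg] at this
    exact (mul_pos_iff_of_pos_left (Real.exp_pos _)).1 this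

theorem K_nonneg (x : ℝ) : 0 ≤ K x := by
  by_cases hx : x = 0
  · simp [hx, K, kernelV, kernelR, kernelS]
  · exact (K_pos hx).le

theorem measurable_artanh : Measurable Real.artanh := by
  unfold Real.artanh
  fun_prop

theorem measurable_K : Measurable K := by
  have hR : Measurable kernelR := by
    unfold kernelR
    refine Measurable.ite measurableSet_Iio ?_ (Measurable.ite measurableSet_Ioi ?_ measurable_const)
    · have := measurable_artanh
      fun_prop
    · have := measurable_artanh
      fun_prop
  have hS : Measurable kernelS := by
    unfold kernelS
    refine Measurable.ite measurableSet_Iio ?_ (Measurable.ite measurableSet_Ioi ?_ measurable_const)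
    · fun_prop
    · fun_prop
  have hV : Measurable kernelV := hR.add hS
  unfold K
  fun_prop

/-- A lower bound for the denominators of the kernel that is linear at 0 and costs only a factor
e^{δx} at -∞. -/
theorem neg_mul_exp_le_one_sub_exp {δ x : ℝ} (hδ₁ : δ ≤ 1) (hx : x ≤ 0) :
    -(δ * x) * Real.exp (δ * x) ≤ 1 - Real.exp x := by
  have h₁ : Real.exp x ≤ Real.exp (δ * x) := Real.exp_le_exp.2 (by nlinarith)
  have h₂ := Real.add_one_le_exp (-(δ * x))
  have h₃ : Real.exp (-(δ * x)) * Real.exp (δ * x) = 1 := by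
    rw [← Real.exp_add, neg_add_cancel, Real.exp_zero]
  nlinarith [Real.exp_pos (δ * x)]

/-- The kernel behaves like |x| e^x at -∞ and like |x|^{-1/2} at 0; giving up δ in the exponent
absorbs the factor |x|. -/
theorem K_le {δ x : ℝ} (hδ : 0 < δ) (hδ₁ : δ ≤ 1) (hx : x < 0) :
    K x ≤ 2 / δ * Real.exp ((1 - δ) * x)
      + 6 / √δ * ((-x) ^ (-(1 / 2) : ℝ) * Real.exp ((1 - δ) * x)) := by
  have hp₀ := Real.exp_pos (x / 2)
  have hp₁ : Real.exp (x / 2) < 1 := Real.exp_lt_one_iff.2 (by linarith)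
  have hlow := neg_mul_exp_le_one_sub_exp hδ₁ hx.le
  have hpos : 0 < -(δ * x) * Real.exp (δ * x) := mul_pos (by nlinarith) (Real.exp_pos _)
  have e2 : Real.exp (x / 2) ^ 2 = Real.exp x := by
    rw [← Real.exp_nat_mul]; congr 1; push_cast; ring
  have e4 : Real.exp (x / 2) ^ 4 = Real.exp (2 * x) := by
    rw [← Real.exp_nat_mul]; congr 1; push_cast; ring
  have hsplit : Real.exp x = Real.exp ((1 - δ) * x) * Real.exp (δ * x) := by
    rw [← Real.exp_add]; ring_nf
  rw [K, kernelV_of_lt_one hp₀ hp₁, e4, Real.log_exp]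
  refine add_le_add ?_ ?_
  · have h2x : Real.exp (2 * x) ≤ Real.exp x := Real.exp_le_exp.2 (by linarith)
    rw [e2, div_le_iff₀ (by linarith)]
    calc -(4 * Real.exp x * (x / 2))
        = 2 / δ * Real.exp ((1 - δ) * x) * (-(δ * x) * Real.exp (δ * x)) := by
          rw [hsplit]; field_simp; ring
      _ ≤ _ := by
          gcongr
          linarith
  · refine (mul_le_mul_of_nonneg_left (arcsin_sub_arsinh_le hp₀ hp₁) (by positivity)).trans ?_
    have e : 2 / Real.exp (x / 2) * (3 * Real.exp (x / 2) ^ 3 / √(1 - Real.exp (x / 2) ^ 2))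
        = 6 * Real.exp x / √(1 - Real.exp x) := by
      rw [e2, show Real.exp (x / 2) ^ 3 = Real.exp (x / 2) * Real.exp x by rw [← e2]; ring]
      field_simp
      norm_num
    rw [e, Real.rpow_neg (by linarith), ← Real.sqrt_eq_rpow]
    have hδx : Real.exp (δ * x) ≤ 1 := Real.exp_le_one_iff.2 (by nlinarith)
    have hroot : √δ * √(-x) * Real.exp (δ * x) ≤ √(1 - Real.exp x) := by
      refine Real.le_sqrt_of_sq_le ?_
      rw [mul_pow, mul_pow, Real.sq_sqrt hδ.le, Real.sq_sqrt (by linarith)]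
      refine le_trans ?_ hlow
      nlinarith [Real.exp_pos (δ * x)]
    have hsx : 0 < √(-x) := Real.sqrt_pos.2 (by linarith)
    have hsd : 0 < √δ := Real.sqrt_pos.2 hδ
    rw [div_le_iff₀ (Real.sqrt_pos.2 (by linarith))]
    calc 6 * Real.exp x
        = 6 / √δ * ((√(-x))⁻¹ * Real.exp ((1 - δ) * x)) * (√δ * √(-x) * Real.exp (δ * x)) := by
          rw [hsplit]; field_simp
      _ ≤ _ := by gcongr

theorem integrableOn_Ioi_comp_neg_iff {f : ℝ → ℝ} :
    IntegrableOn (fun x => f (-x)) (Ioi 0) ↔ IntegrableOn f (Iio 0) := by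
  have h := (Measure.measurePreserving_neg (volume : Measure ℝ)).integrableOn_comp_preimage
    (Homeomorph.neg ℝ).measurableEmbedding (f := f) (s := Iio 0)
  have e : (Neg.neg ⁻¹' Iio 0 : Set ℝ) = Ioi 0 := by
    ext x
    simp
  rwa [e] at h

theorem integrableOn_K_Iio {σ : ℝ} (hσ : -1 < σ) :
    IntegrableOn (fun x => K x * Real.exp (σ * x)) (Iio 0) := by
  -- This loss keeps the remaining rate 1 - δ + σ positive.
  set δ := min 1 ((1 + σ) / 2) with hδdef
  have hδ : 0 < δ := lt_min one_pos (by linarith)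
  have hδ₁ : δ ≤ 1 := min_le_left _ _
  have hδ₂ : δ ≤ (1 + σ) / 2 := min_le_right _ _
  have hc : 0 < 1 - δ + σ := by linarith
  have h₁ : IntegrableOn (fun x : ℝ => Real.exp ((1 - δ + σ) * x)) (Iio 0) :=
    (integrableOn_exp_mul_Iic hc 0).mono_set Iio_subset_Iic_self
  have h₂ : IntegrableOn (fun x : ℝ => (-x) ^ (-(1 / 2) : ℝ) * Real.exp ((1 - δ + σ) * x))
      (Iio 0) := by
    have h := integrableOn_rpow_mul_exp_neg_mul_rpow (p := 1) (s := -(1 / 2)) (b := 1 - δ + σ)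
      (by norm_num) (by norm_num) hc
    refine integrableOn_Ioi_comp_neg_iff.1 (h.congr_fun (fun x hx => ?_) measurableSet_Ioi)
    simp only [neg_neg, Real.rpow_one, neg_mul, mul_neg]
  refine ((h₁.const_mul (2 / δ)).add (h₂.const_mul (6 / √δ))).mono'
    ((measurable_K.mul (by fun_prop)).aestronglyMeasurable) ?_
  refine (ae_restrict_iff' measurableSet_Iio).2 (Filter.Eventually.of_forall fun x hx => ?_)
  rw [Real.norm_of_nonneg (mul_nonneg (K_nonneg x) (Real.exp_pos _).le)]
  refine (mul_le_mul_of_nonneg_right (K_le hδ hδ₁ hx) (Real.exp_pos _).le).trans_eq ?_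
  rw [Pi.add_apply, add_mul (1 - δ) σ x, Real.exp_add]
  ring

/-- By `K_neg` the right half-line with weight σ is the left one with weight 3/2 - σ, and 3/2 - σ >
-1 is the upper bound on σ. -/
theorem integrable_K {σ : ℝ} (h₁ : -1 < σ) (h₂ : σ < 5 / 2) :
    Integrable fun x => K x * Real.exp (σ * x) := by
  have hneg := integrableOn_K_Iio h₁
  have hpos : IntegrableOn (fun x => K x * Real.exp (σ * x)) (Ioi 0) := by
    have h := integrableOn_K_Iio (σ := 3 / 2 - σ) (by linarith)
    rw [← integrableOn_Ioi_comp_neg_iff] at h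
    refine h.congr_fun (fun x _ => ?_) measurableSet_Ioi
    simp only
    rw [K_neg, mul_right_comm, ← Real.exp_add, mul_comm]
    ring_nf
  have h := ((integrableOn_Iic_iff_integrableOn_Iio (by finiteness)).2 hneg).union hpos
  rwa [Iic_union_Ioi, integrableOn_univ] at h

end Kernel

/-! ### The series `∑ εⁿ x^(2n+1) / (2n+1)²` -/

section OddDilog

/-- For `ε = 1` this is Legendre's `χ₂`, for `ε = -1` the inverse tangent integral. -/
noncomputable def oddDilog (ε x : ℝ) : ℝ := ∑' n : ℕ, ε ^ n * x ^ (2 * n + 1) / (2 * n + 1) ^ 2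

theorem summable_one_div_odd_sq : Summable fun n : ℕ => 1 / (2 * (n : ℝ) + 1) ^ 2 := by
  have h : Summable fun n : ℕ => 1 / (n : ℝ) ^ 2 := Real.summable_one_div_nat_pow.2 one_lt_two
  have := h.comp_injective (i := fun n : ℕ => 2 * n + 1) (fun a b hab => by simpa using hab)
  refine this.congr fun n => ?_
  simp

theorem tsum_one_div_odd_sq : ∑' n : ℕ, 1 / (2 * (n : ℝ) + 1) ^ 2 = Real.pi ^ 2 / 8 := by
  have he : HasSum (fun n : ℕ => 1 / ((2 * n : ℕ) : ℝ) ^ 2) (Real.pi ^ 2 / 6 / 4) :=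
    (hasSum_zeta_two.div_const 4).congr_fun fun n => by
      push_cast
      rw [mul_pow, div_div, mul_comm]
      norm_num
  have ho : HasSum (fun n : ℕ => 1 / ((2 * n + 1 : ℕ) : ℝ) ^ 2)
      (∑' n : ℕ, 1 / (2 * (n : ℝ) + 1) ^ 2) :=
    summable_one_div_odd_sq.hasSum.congr_fun fun n => by push_cast; rfl
  have h := (he.even_add_odd (f := fun n : ℕ => 1 / (n : ℝ) ^ 2) ho).unique hasSum_zeta_two
  linarith

theorem continuousOn_oddDilog {ε : ℝ} (hε : |ε| ≤ 1) : ContinuousOn (oddDilog ε) (Icc 0 1) := by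
  refine continuousOn_tsum (fun n => by fun_prop) summable_one_div_odd_sq fun n x hx => ?_
  rw [norm_div, norm_mul, norm_pow, norm_pow, Real.norm_eq_abs, Real.norm_eq_abs,
    abs_of_nonneg hx.1, Real.norm_of_nonneg (by positivity)]
  gcongr
  exact mul_le_one₀ (pow_le_one₀ (abs_nonneg _) hε) (pow_nonneg hx.1 _) (pow_le_one₀ hx.1 hx.2)

theorem hasDerivAt_oddDilog {ε x : ℝ} (hε : |ε| ≤ 1) (hx₀ : 0 < x) (hx₁ : x < 1) :
    HasDerivAt (oddDilog ε) (∑' n : ℕ, ε ^ n * x ^ (2 * n) / (2 * n + 1)) x := by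
  obtain ⟨r, hxr, hr⟩ := exists_between hx₁
  have hr0 : 0 < r := hx₀.trans hxr
  have hr2 : r ^ 2 < 1 := pow_lt_one₀ hr0.le hr two_ne_zero
  refine hasDerivAt_tsum_of_isPreconnected (t := Ioo (-r) r) (y₀ := 0)
    (u := fun n : ℕ => (r ^ 2) ^ n)
    (g := fun (n : ℕ) (x : ℝ) => ε ^ n * x ^ (2 * n + 1) / (2 * n + 1) ^ 2)
    (g' := fun (n : ℕ) (x : ℝ) => ε ^ n * x ^ (2 * n) / (2 * n + 1))
    (summable_geometric_of_lt_one (by positivity) hr2)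
    isOpen_Ioo isPreconnected_Ioo (fun n y _ => ?_) (fun n y hy => ?_) ⟨by linarith, hr0⟩ ?_
    ⟨by linarith, hxr⟩
  · have h := ((hasDerivAt_pow (2 * n + 1) y).const_mul (ε ^ n)).div_const ((2 * (n : ℝ) + 1) ^ 2)
    refine h.congr_deriv ?_
    have : 2 * (n : ℝ) + 1 ≠ 0 := by positivity
    push_cast
    field_simp
  · rw [norm_div, norm_mul, norm_pow, norm_pow, Real.norm_eq_abs, Real.norm_eq_abs,
      Real.norm_of_nonneg (by positivity), ← pow_mul]
    have h1 : |ε| ^ n ≤ 1 := pow_le_one₀ (abs_nonneg _) hε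
    have h2 : |y| ^ (2 * n) ≤ r ^ (2 * n) :=
      pow_le_pow_left₀ (abs_nonneg _) (abs_le.2 ⟨hy.1.le, hy.2.le⟩) _
    refine div_le_of_le_mul₀ (by positivity) (by positivity) ?_
    have h3 : 0 ≤ (n : ℝ) := by positivity
    have h4 : 0 ≤ r ^ (2 * n) := by positivity
    have h5 : |ε| ^ n * |y| ^ (2 * n) ≤ 1 * r ^ (2 * n) := by gcongr
    nlinarith
  · refine summable_zero.congr fun n => ?_
    simp

/-- Half the logarithm of `(1 + x) / (1 - x)`, in a form convenient for differentiation. -/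
noncomputable def halfLog (x : ℝ) : ℝ := (Real.log (1 + x) - Real.log (1 - x)) / 2

theorem hasDerivAt_oddDilog_one {x : ℝ} (hx₀ : 0 < x) (hx₁ : x < 1) :
    HasDerivAt (oddDilog 1) (halfLog x / x) x := by
  have h := hasDerivAt_oddDilog (ε := 1) (by simp) hx₀ hx₁
  have hs := (Real.hasSum_log_sub_log_of_abs_lt_one (x := x)
    (by rw [abs_of_pos hx₀]; exact hx₁)).div_const (2 * x)
  have e : HasSum (fun n : ℕ => (1 : ℝ) ^ n * x ^ (2 * n) / (2 * n + 1)) (halfLog x / x) := by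
    rw [halfLog, div_div]
    refine hs.congr_fun fun n => ?_
    rw [pow_succ]
    field_simp
    simp
  rwa [e.tsum_eq] at h

theorem hasDerivAt_oddDilog_neg_one {x : ℝ} (hx₀ : 0 < x) (hx₁ : x < 1) :
    HasDerivAt (oddDilog (-1)) (Real.arctan x / x) x := by
  have h := hasDerivAt_oddDilog (ε := -1) (by simp) hx₀ hx₁
  have hs := (Real.hasSum_arctan (x := x)
    (by rw [Real.norm_of_nonneg hx₀.le]; exact hx₁)).div_const x
  have e : HasSum (fun n : ℕ => (-1 : ℝ) ^ n * x ^ (2 * n) / (2 * n + 1))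
      (Real.arctan x / x) := by
    refine hs.congr_fun fun n => ?_
    push_cast
    rw [pow_succ]
    field_simp
  rwa [e.tsum_eq] at h

theorem oddDilog_zero (ε : ℝ) : oddDilog ε 0 = 0 := by
  simp [oddDilog]

theorem oddDilog_one_one : oddDilog 1 1 = Real.pi ^ 2 / 8 := by
  simp only [oddDilog, one_pow, one_mul]
  exact tsum_one_div_odd_sq

theorem oddDilog_neg_one_one : oddDilog (-1) 1 = catalanG := by
  simp [oddDilog, catalanG]

theorem hasDerivAt_halfLog {x : ℝ} (h₁ : -1 < x) (h₂ : x < 1) :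
    HasDerivAt halfLog (1 / (1 - x ^ 2)) x := by
  have a : HasDerivAt (fun y : ℝ => Real.log (1 + y)) (1 / (1 + x)) x :=
    ((hasDerivAt_id x).const_add 1).log (by simp; linarith)
  have b : HasDerivAt (fun y : ℝ => Real.log (1 - y)) (-1 / (1 - x)) x :=
    ((hasDerivAt_id x).const_sub 1).log (by simp; linarith)
  refine ((a.sub b).div_const 2).congr_deriv ?_
  have : 1 + x ≠ 0 := by linarith
  have : 1 - x ≠ 0 := by linarith
  rw [show 1 - x ^ 2 = (1 + x) * (1 - x) by ring]
  field_simp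
  ring

/-- Legendre's reflection formula for `χ₂`. -/
theorem oddDilog_add_oddDilog {x : ℝ} (hx₀ : 0 < x) (hx₁ : x < 1) :
    oddDilog 1 x + oddDilog 1 ((1 - x) / (1 + x)) = Real.pi ^ 2 / 8 + Real.log x * halfLog x := by
  set h : ℝ → ℝ := fun y =>
    oddDilog 1 y + oddDilog 1 ((1 - y) / (1 + y)) - Real.log y * halfLog y with hdef
  have hd : ∀ y ∈ Ioo (0 : ℝ) 1, HasDerivAt h 0 y := by
    rintro y ⟨hy₀, hy₁⟩
    have h1y : 0 < 1 + y := by linarith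
    have h1y' : 0 < 1 - y := by linarith
    have hz₀ : 0 < (1 - y) / (1 + y) := by positivity
    have hz₁ : (1 - y) / (1 + y) < 1 := by
      rw [div_lt_one h1y]
      linarith
    have hz : HasDerivAt (fun y : ℝ => (1 - y) / (1 + y)) (-2 / (1 + y) ^ 2) y := by
      have := ((hasDerivAt_id y).const_sub 1).div ((hasDerivAt_id y).const_add 1) h1y.ne'
      refine this.congr_deriv ?_
      simp only [id]
      ring
    have e : halfLog ((1 - y) / (1 + y)) = -Real.log y / 2 := by
      rw [halfLog, show 1 + (1 - y) / (1 + y) = 2 / (1 + y) by field_simp; ring,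
        show 1 - (1 - y) / (1 + y) = 2 * y / (1 + y) by field_simp; ring,
        Real.log_div two_ne_zero h1y.ne', Real.log_div (by positivity) h1y.ne',
        Real.log_mul two_ne_zero hy₀.ne']
      ring
    have hc := (hasDerivAt_oddDilog_one hz₀ hz₁).comp y hz
    have := ((hasDerivAt_oddDilog_one hy₀ hy₁).add hc).sub
      ((Real.hasDerivAt_log hy₀.ne').mul (hasDerivAt_halfLog (by linarith) hy₁))
    refine this.congr_deriv ?_
    rw [e, show 1 - y ^ 2 = (1 + y) * (1 - y) by ring]
    field_simp
    ring
  have hconst : ∀ y ∈ Ioo (0 : ℝ) 1, h y = h x := fun y hy =>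
    isOpen_Ioo.is_const_of_deriv_eq_zero isPreconnected_Ioo
      (fun z hz => (hd z hz).differentiableAt.differentiableWithinAt)
      (fun z hz => (hd z hz).deriv) hy ⟨hx₀, hx₁⟩
  -- The constant is read off at 0⁺, where χ₂(1) = π²/8 and log y · halfLog y = (y log y)(halfLog y
  -- / y) tends to 0 · 1.
  have hlim : Filter.Tendsto h (nhdsWithin 0 (Ioi 0)) (nhds (0 + Real.pi ^ 2 / 8 - 0 * 1)) := by
    have hmem : Ioo (0 : ℝ) 1 ∈ nhdsWithin (0 : ℝ) (Ioi 0) := Ioo_mem_nhdsGT one_pos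
    have hid : Filter.Tendsto (fun y : ℝ => y) (nhdsWithin 0 (Ioi 0)) (nhds 0) :=
      tendsto_nhdsWithin_of_tendsto_nhds Filter.tendsto_id
    refine (Filter.Tendsto.add ?_ ?_).sub ?_
    · have := (continuousOn_oddDilog (ε := 1) (by simp)) 0 ⟨le_rfl, zero_le_one⟩
      rw [ContinuousWithinAt, oddDilog_zero] at this
      refine this.comp (tendsto_nhdsWithin_iff.2 ⟨hid, ?_⟩)
      filter_upwards [hmem] with y hy using ⟨hy.1.le, hy.2.le⟩
    · have := (continuousOn_oddDilog (ε := 1) (by simp)) 1 ⟨zero_le_one, le_rfl⟩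
      rw [ContinuousWithinAt, oddDilog_one_one] at this
      refine this.comp (tendsto_nhdsWithin_iff.2 ⟨?_, ?_⟩)
      · have : Filter.Tendsto (fun y : ℝ => (1 - y) / (1 + y)) (nhdsWithin 0 (Ioi 0))
            (nhds ((1 - 0) / (1 + 0))) :=
          (hid.const_sub 1).div (hid.const_add 1) (by norm_num)
        simpa using this
      · filter_upwards [hmem] with y hy
        have : 0 < 1 + y := by linarith [hy.1]
        refine ⟨div_nonneg (by linarith [hy.2]) this.le, ?_⟩
        rw [div_le_one this]
        linarith [hy.1]
    · have a : Filter.Tendsto (fun y : ℝ => y * Real.log y) (nhdsWithin 0 (Ioi 0)) (nhds 0) := by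
        have := (Real.continuous_mul_log.tendsto 0).mono_left
          (nhdsWithin_le_nhds (s := Ioi (0 : ℝ)))
        simpa using this
      have b : Filter.Tendsto (slope halfLog 0) (nhdsWithin 0 (Ioi 0)) (nhds 1) := by
        have := hasDerivAt_iff_tendsto_slope.1
          (hasDerivAt_halfLog (x := 0) (by norm_num) (by norm_num))
        have := this.mono_left (nhdsWithin_mono 0 (s := Ioi 0) fun y hy => ne_of_gt hy)
        simpa using this
      refine (a.mul b).congr' ?_
      filter_upwards [self_mem_nhdsWithin] with y hy
      have hy : y ≠ 0 := ne_of_gt hy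
      simp only [slope, halfLog, vsub_eq_sub, smul_eq_mul, add_zero, sub_zero, Real.log_one,
        zero_div]
      field_simp
  have hlim' : Filter.Tendsto h (nhdsWithin 0 (Ioi 0)) (nhds (h x)) := by
    refine tendsto_const_nhds.congr' ?_
    filter_upwards [Ioo_mem_nhdsGT one_pos] with y hy using (hconst y hy).symm
  have := tendsto_nhds_unique hlim' hlim
  simp only [hdef] at this
  linarith

/-- The half-angle formula for `arsinh`. -/
theorem arsinh_eq_two_mul_halfLog {p : ℝ} (h₀ : 0 ≤ p) :
    Real.arsinh p = 2 * halfLog (p / (1 + √(1 + p ^ 2))) := by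
  have hr : p < √(1 + p ^ 2) := Real.lt_sqrt_of_sq_lt (by linarith)
  have hrr : √(1 + p ^ 2) ^ 2 = 1 + p ^ 2 := Real.sq_sqrt (by positivity)
  rw [Real.arsinh]
  set r := √(1 + p ^ 2)
  have h1 : 0 < 1 + r := by linarith
  have h2 : 0 < 1 + r - p := by linarith
  have h3 : 0 < 1 + r + p := by linarith
  rw [halfLog, show 1 + p / (1 + r) = (1 + r + p) / (1 + r) by field_simp,
    show 1 - p / (1 + r) = (1 + r - p) / (1 + r) by field_simp,
    mul_div_cancel₀ _ two_ne_zero, ← Real.log_div (by positivity) (by positivity)]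
  congr 1
  field_simp
  nlinarith

/-- The value of `χ₂` at `√2 - 1`. -/
theorem oddDilog_one_inv : 2 * oddDilog 1 (1 / (1 + √2)) = Real.pi ^ 2 / 8
    - Real.arsinh 1 ^ 2 / 2 := by
  have h2 : √2 ^ 2 = 2 := Real.sq_sqrt (by norm_num)
  have h0 : 0 < √2 := by positivity
  have h := oddDilog_add_oddDilog (x := 1 / (1 + √2)) (by positivity)
    (by rw [div_lt_one (by positivity)]; linarith)
  -- √2 - 1 is the fixed point of y ↦ (1 - y)/(1 + y), so both terms of the reflection formula
  -- coincide.
  have e : (1 - 1 / (1 + √2)) / (1 + 1 / (1 + √2)) = 1 / (1 + √2) := by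
    field_simp
    nlinarith
  have ea := arsinh_eq_two_mul_halfLog zero_le_one
  rw [show (1 : ℝ) + 1 ^ 2 = 2 by norm_num] at ea
  have el : Real.log (1 / (1 + √2)) = -Real.arsinh 1 := by
    rw [one_div, Real.log_inv, Real.arsinh, show (1 : ℝ) + 1 ^ 2 = 2 by norm_num]
  rw [e, el] at h
  rw [show halfLog (1 / (1 + √2)) = Real.arsinh 1 / 2 by linarith] at h
  linarith

end OddDilog

/-! ### The integral of the kernel against `e^{x/2}` -/

section KernelIntegral

/-- A primitive of `(1 + p) (2 / p) (arcsin p / √(1 - p²) - arsinh p / √(1 + p²))`. -/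
noncomputable def arcPrimitive (p : ℝ) : ℝ :=
  Real.arcsin p ^ 2 - Real.arsinh p ^ 2
    + 4 * oddDilog (-1) (p / (1 + √(1 - p ^ 2))) - 4 * oddDilog 1 (p / (1 + √(1 + p ^ 2)))

theorem continuousOn_arcPrimitive : ContinuousOn arcPrimitive (Icc 0 1) := by
  have h₁ : ContinuousOn (fun p : ℝ => oddDilog (-1) (p / (1 + √(1 - p ^ 2)))) (Icc 0 1) := by
    refine (continuousOn_oddDilog (ε := -1) (by simp)).comp (f := fun p => p / (1 + √(1 - p ^ 2)))
      ?_ fun p hp => ?_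
    · refine Continuous.continuousOn (Continuous.div (by fun_prop) (by fun_prop) fun p => ?_)
      positivity
    · have := Real.sqrt_nonneg (1 - p ^ 2)
      refine ⟨div_nonneg hp.1 (by positivity), ?_⟩
      rw [div_le_one (by positivity)]
      linarith [hp.2]
  have h₂ : ContinuousOn (fun p : ℝ => oddDilog 1 (p / (1 + √(1 + p ^ 2)))) (Icc 0 1) := by
    refine (continuousOn_oddDilog (ε := 1) (by simp)).comp (f := fun p => p / (1 + √(1 + p ^ 2)))
      ?_ fun p hp => ?_
    · refine Continuous.continuousOn (Continuous.div (by fun_prop) (by fun_prop) fun p => ?_)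
      positivity
    · have := Real.sqrt_nonneg (1 + p ^ 2)
      refine ⟨div_nonneg hp.1 (by positivity), ?_⟩
      rw [div_le_one (by positivity)]
      linarith [hp.2]
  have h₃ : ContinuousOn (fun p => Real.arcsin p ^ 2 - Real.arsinh p ^ 2) (Icc 0 1) :=
    ((Real.continuous_arcsin.pow 2).sub (Real.continuous_arsinh.pow 2)).continuousOn
  exact (h₃.add (h₁.const_mul 4)).sub (h₂.const_mul 4)

/-- In (1 + p)(2/p) = 2 + 2/p, the term 2 gives the squares; the term 2/p gives the dilogarithms, by
the half-angle substitutions u = p/(1 + √(1 ∓ p²)). -/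
theorem hasDerivAt_arcPrimitive {p : ℝ} (h₀ : 0 < p) (h₁ : p < 1) :
    HasDerivAt arcPrimitive ((1 + p) * (2 / p *
      (Real.arcsin p / √(1 - p ^ 2) - Real.arsinh p / √(1 + p ^ 2)))) p := by
  have h1p : 0 < 1 - p ^ 2 := by nlinarith
  have hs : 0 < √(1 - p ^ 2) := Real.sqrt_pos.2 h1p
  have hss : √(1 - p ^ 2) ^ 2 = 1 - p ^ 2 := Real.sq_sqrt h1p.le
  have hr : 1 < √(1 + p ^ 2) := by rw [Real.lt_sqrt (by norm_num)]; nlinarith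
  have hrr : √(1 + p ^ 2) ^ 2 = 1 + p ^ 2 := Real.sq_sqrt (by positivity)
  have dsq : HasDerivAt (fun x : ℝ => x ^ 2) (2 * p) p := by simpa using hasDerivAt_pow 2 p
  have d₁ : HasDerivAt (fun p : ℝ => p / (1 + √(1 - p ^ 2)))
      (1 / (√(1 - p ^ 2) * (1 + √(1 - p ^ 2)))) p := by
    have ds := ((dsq.const_sub 1).sqrt h1p.ne').const_add 1
    refine ((hasDerivAt_id p).div ds (by positivity)).congr_deriv ?_
    set s := √(1 - p ^ 2)
    simp only [id]
    field_simp
    nlinarith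
  have d₂ : HasDerivAt (fun p : ℝ => p / (1 + √(1 + p ^ 2)))
      (1 / (√(1 + p ^ 2) * (1 + √(1 + p ^ 2)))) p := by
    have ds := ((dsq.const_add 1).sqrt (by positivity)).const_add 1
    refine ((hasDerivAt_id p).div ds (by positivity)).congr_deriv ?_
    set r := √(1 + p ^ 2)
    have : 0 < r := by linarith
    simp only [id]
    field_simp
    nlinarith
  have e₁ := arcsin_eq_two_mul_arctan h₀.le h₁.le
  have e₂ := arsinh_eq_two_mul_halfLog h₀.le
  have c₁ := (hasDerivAt_oddDilog_neg_one (x := p / (1 + √(1 - p ^ 2))) (by positivity)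
    (by rw [div_lt_one (by positivity)]; linarith)).comp p d₁
  have c₂ := (hasDerivAt_oddDilog_one (x := p / (1 + √(1 + p ^ 2))) (by positivity)
    (by rw [div_lt_one (by positivity)]; linarith)).comp p d₂
  have c₃ := (Real.hasDerivAt_arcsin (by linarith : p ≠ -1) h₁.ne).pow 2
  have c₄ := (Real.hasDerivAt_arsinh p).pow 2
  refine (((c₃.sub c₄).add (c₁.const_mul 4)).sub (c₂.const_mul 4)).congr_deriv ?_
  rw [show Real.arctan (p / (1 + √(1 - p ^ 2))) = Real.arcsin p / 2 by linarith,
    show halfLog (p / (1 + √(1 + p ^ 2))) = Real.arsinh p / 2 by linarith]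
  have : 0 < √(1 + p ^ 2) := by linarith
  field_simp
  ring

theorem arcPart_nonneg {p : ℝ} (hp : p ∈ Ioo (0 : ℝ) 1) : 0 ≤ (1 + p) * (2 / p *
    (Real.arcsin p / √(1 - p ^ 2) - Real.arsinh p / √(1 + p ^ 2))) :=
  mul_nonneg (by linarith [hp.1]) (mul_nonneg (div_nonneg zero_le_two hp.1.le)
    (arcsin_sub_arsinh_nonneg hp.1 hp.2))

theorem integrableOn_arcPart : IntegrableOn (fun p : ℝ => (1 + p) * (2 / p *
    (Real.arcsin p / √(1 - p ^ 2) - Real.arsinh p / √(1 + p ^ 2)))) (Ioc 0 1) :=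
  intervalIntegral.integrableOn_deriv_of_nonneg continuousOn_arcPrimitive
    (fun _ hp => hasDerivAt_arcPrimitive hp.1 hp.2) fun _ hp => arcPart_nonneg hp

/-- At p = 1, `oddDilog_one_inv` cancels both π²/4 and arsinh(1)², leaving only Catalan's constant.
-/
theorem integral_arcPart : ∫ p in Ioc (0 : ℝ) 1, (1 + p) * (2 / p *
    (Real.arcsin p / √(1 - p ^ 2) - Real.arsinh p / √(1 + p ^ 2))) = 4 * catalanG := by
  rw [← intervalIntegral.integral_of_le zero_le_one,
    intervalIntegral.integral_eq_sub_of_hasDerivAt_of_le zero_le_one continuousOn_arcPrimitive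
      (fun _ hp => hasDerivAt_arcPrimitive hp.1 hp.2)
      ((intervalIntegrable_iff_integrableOn_Ioc_of_le zero_le_one).2 integrableOn_arcPart)]
  have h := oddDilog_one_inv
  simp only [arcPrimitive, Real.arcsin_one, Real.arcsin_zero, Real.arsinh_zero, zero_div,
    oddDilog_zero, one_pow, sub_self, Real.sqrt_zero, add_zero, div_one, oddDilog_neg_one_one]
  rw [show (1 : ℝ) + 1 = 2 by norm_num]
  linarith

theorem integral_neg_log_mul_pow (k : ℕ) :
    IntegrableOn (fun p : ℝ => -Real.log p * p ^ k) (Ioc 0 1) ∧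
      ∫ p in Ioc (0 : ℝ) 1, -Real.log p * p ^ k = 1 / ((k : ℝ) + 1) ^ 2 := by
  -- The primitive is written with p log p kept together, so that its continuity at 0 is available.
  set P : ℝ → ℝ := fun p => p ^ (k + 1) / ((k : ℝ) + 1) ^ 2
    - p ^ k * (p * Real.log p) / ((k : ℝ) + 1) with hP
  have hk : (k : ℝ) + 1 ≠ 0 := by positivity
  have hc : ContinuousOn P (Icc 0 1) := by
    have := Real.continuous_mul_log
    refine Continuous.continuousOn (Continuous.sub (by fun_prop) (Continuous.div_const ?_ _))
    exact (continuous_pow k).mul this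
  have hd : ∀ p ∈ Ioo (0 : ℝ) 1, HasDerivAt P (-Real.log p * p ^ k) p := by
    rintro p ⟨hp, -⟩
    have h1 := (hasDerivAt_pow (k + 1) p).div_const (((k : ℝ) + 1) ^ 2)
    have h2 := (((hasDerivAt_pow (k + 1) p).mul (Real.hasDerivAt_log hp.ne'))).div_const
      ((k : ℝ) + 1)
    have h3 : HasDerivAt (fun p => p ^ (k + 1) / ((k : ℝ) + 1) ^ 2
        - (p ^ (k + 1) * Real.log p) / ((k : ℝ) + 1)) (-Real.log p * p ^ k) p := by
      refine (h1.sub h2).congr_deriv ?_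
      push_cast
      rw [pow_succ]
      field_simp
      ring
    refine h3.congr_of_eventuallyEq (Filter.Eventually.of_forall fun q => ?_)
    simp only [hP]
    ring
  have hi := intervalIntegral.integrableOn_deriv_of_nonneg hc hd fun p hp =>
    mul_nonneg (neg_nonneg.2 (Real.log_nonpos hp.1.le hp.2.le)) (pow_nonneg hp.1.le k)
  refine ⟨hi, ?_⟩
  rw [← intervalIntegral.integral_of_le zero_le_one,
    intervalIntegral.integral_eq_sub_of_hasDerivAt_of_le zero_le_one hc hd
      ((intervalIntegrable_iff_integrableOn_Ioc_of_le zero_le_one).2 hi)]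
  simp [hP]

/-- With a and b the sums of 1/(4n+1)² and 1/(4n+3)², one has a + b = π²/8 and a - b = G, which
determines b; the multiples of 4 contribute π²/96. -/
theorem hasSum_logPart : HasSum (fun n : ℕ => 4 * (1 / (4 * (n : ℝ) + 3) ^ 2
    + 1 / (4 * (n : ℝ) + 4) ^ 2)) (7 * Real.pi ^ 2 / 24 - 2 * catalanG) := by
  have inj : ∀ j : ℕ, Function.Injective fun n : ℕ => 4 * n + j := fun j a b h => by
    simpa using h
  have hs : Summable fun n : ℕ => 1 / (n : ℝ) ^ 2 := hasSum_zeta_two.summable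
  have s1 : Summable fun n : ℕ => 1 / (4 * (n : ℝ) + 1) ^ 2 :=
    (hs.comp_injective (inj 1)).congr fun n => by simp
  have s3 : Summable fun n : ℕ => 1 / (4 * (n : ℝ) + 3) ^ 2 :=
    (hs.comp_injective (inj 3)).congr fun n => by simp
  obtain ⟨a, s1⟩ := s1
  obtain ⟨b, s3⟩ := s3
  have h4 : HasSum (fun n : ℕ => 1 / (4 * (n : ℝ) + 4) ^ 2) (Real.pi ^ 2 / 6 / 16) := by
    have h := (hasSum_nat_add_iff' 1).2 hasSum_zeta_two
    simp only [Finset.range_one, Finset.sum_singleton, Nat.cast_zero, ne_eq, OfNat.ofNat_ne_zero,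
      not_false_eq_true, zero_pow, div_zero, sub_zero] at h
    refine (h.div_const 16).congr_fun fun n => ?_
    push_cast
    rw [show 4 * (n : ℝ) + 4 = 4 * (n + 1) by ring, mul_pow, div_div, mul_comm]
    norm_num
  have hodd := (s1.congr_fun (g := fun n : ℕ => 1 / (2 * ((2 * n : ℕ) : ℝ) + 1) ^ 2)
      fun n => by push_cast; ring_nf).even_add_odd
    (f := fun n : ℕ => 1 / (2 * (n : ℝ) + 1) ^ 2)
    (s3.congr_fun (g := fun n : ℕ => 1 / (2 * ((2 * n + 1 : ℕ) : ℝ) + 1) ^ 2)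
      fun n => by push_cast; ring_nf)
  have hcat := (s1.congr_fun
      (g := fun n : ℕ => (-1 : ℝ) ^ (2 * n) / (2 * ((2 * n : ℕ) : ℝ) + 1) ^ 2)
      fun n => by rw [pow_mul]; push_cast; ring_nf).even_add_odd
    (f := fun n : ℕ => (-1 : ℝ) ^ n / (2 * (n : ℝ) + 1) ^ 2)
    (s3.neg.congr_fun
      (g := fun n : ℕ => (-1 : ℝ) ^ (2 * n + 1) / (2 * ((2 * n + 1 : ℕ) : ℝ) + 1) ^ 2)
      fun n => by rw [pow_succ, pow_mul]; push_cast; ring_nf)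
  have e1 := hodd.tsum_eq
  rw [tsum_one_div_odd_sq] at e1
  have e2 : catalanG = _ := hcat.tsum_eq
  have h := (s3.add h4).mul_left 4
  rwa [show 7 * Real.pi ^ 2 / 24 - 2 * catalanG = 4 * (b + Real.pi ^ 2 / 6 / 16) by
    rw [e2]; linarith]

theorem logPart_eq_tsum {p : ℝ} (hp : p ∈ Ioo (0 : ℝ) 1) :
    (1 + p) * (-(4 * p ^ 2 * Real.log p) / (1 - p ^ 4))
      = ∑' n : ℕ, 4 * (-Real.log p * p ^ (4 * n + 2) + -Real.log p * p ^ (4 * n + 3)) := by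
  have h4 : p ^ 4 < 1 := pow_lt_one₀ hp.1.le hp.2 (by norm_num)
  have h := (hasSum_geometric_of_lt_one (pow_nonneg hp.1.le 4) h4).mul_left
    (4 * (-Real.log p * (p ^ 2 + p ^ 3)))
  have h' : HasSum (fun n : ℕ => 4 * (-Real.log p * p ^ (4 * n + 2)
      + -Real.log p * p ^ (4 * n + 3))) _ := h.congr_fun fun n => by
    rw [pow_add, pow_add, pow_mul]
    ring
  rw [h'.tsum_eq]
  have : 1 - p ^ 4 ≠ 0 := by linarith
  field_simp

theorem integral_logPart :
    ∫ p in Ioc (0 : ℝ) 1, (1 + p) * (-(4 * p ^ 2 * Real.log p) / (1 - p ^ 4))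
      = 7 * Real.pi ^ 2 / 24 - 2 * catalanG := by
  set F : ℕ → ℝ → ℝ := fun n p =>
    4 * (-Real.log p * p ^ (4 * n + 2) + -Real.log p * p ^ (4 * n + 3)) with hF
  have hi : ∀ n, Integrable (F n) (volume.restrict (Ioc 0 1)) := fun n =>
    ((integral_neg_log_mul_pow _).1.add (integral_neg_log_mul_pow _).1).const_mul 4
  have hv : ∀ n, ∫ p in Ioc (0 : ℝ) 1, F n p
      = 4 * (1 / (4 * (n : ℝ) + 3) ^ 2 + 1 / (4 * (n : ℝ) + 4) ^ 2) := fun n => by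
    simp only [hF]
    rw [integral_const_mul, integral_add (integral_neg_log_mul_pow _).1
      (integral_neg_log_mul_pow _).1, (integral_neg_log_mul_pow _).2,
      (integral_neg_log_mul_pow _).2]
    push_cast
    ring_nf
  have hn : ∀ n, ∫ p in Ioc (0 : ℝ) 1, ‖F n p‖ = ∫ p in Ioc (0 : ℝ) 1, F n p := fun n => by
    refine setIntegral_congr_fun measurableSet_Ioc fun p hp => ?_
    have hl := neg_nonneg.2 (Real.log_nonpos hp.1.le hp.2)
    have hp0 := hp.1.le
    exact Real.norm_of_nonneg (by simp only [hF]; positivity)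
  have h := hasSum_integral_of_summable_integral_norm hi (by
    simp_rw [hn, hv]
    exact hasSum_logPart.summable)
  simp_rw [hv] at h
  rw [← h.unique hasSum_logPart, integral_Ioc_eq_integral_Ioo, integral_Ioc_eq_integral_Ioo]
  exact setIntegral_congr_fun measurableSet_Ioo fun p hp => logPart_eq_tsum hp

theorem integrableOn_logPart :
    IntegrableOn (fun p : ℝ => (1 + p) * (-(4 * p ^ 2 * Real.log p) / (1 - p ^ 4))) (Ioo 0 1) := by
  refine Measure.integrableOn_of_bounded (M := 4) (by simp)
    (Measurable.aestronglyMeasurable (by fun_prop)) ?_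
  refine (ae_restrict_iff' measurableSet_Ioo).2 (Filter.Eventually.of_forall fun p hp => ?_)
  have hp₀ := hp.1
  have h4 : 0 < 1 - p ^ 4 := sub_pos.2 (pow_lt_one₀ hp.1.le hp.2 (by norm_num))
  have hl : -Real.log p ≤ (1 - p) / p := by
    have := Real.log_le_sub_one_of_pos (inv_pos.2 hp₀)
    rw [Real.log_inv] at this
    refine this.trans_eq ?_
    field_simp
  have hl0 : 0 ≤ -Real.log p := neg_nonneg.2 (Real.log_nonpos hp₀.le hp.2.le)
  have e : (1 + p) * (-(4 * p ^ 2 * Real.log p) / (1 - p ^ 4))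
      = (1 + p) * (4 * p ^ 2 * -Real.log p) / (1 - p ^ 4) := by ring
  rw [e, Real.norm_of_nonneg (by positivity), div_le_iff₀ h4]
  calc (1 + p) * (4 * p ^ 2 * -Real.log p) ≤ (1 + p) * (4 * p ^ 2 * ((1 - p) / p)) := by gcongr
    _ = 4 * (p * (1 - p ^ 2)) := by
        field_simp
        ring
    _ ≤ 4 * (1 - p ^ 4) := by
        have := hp.2
        have : 0 < 1 - p ^ 2 := by nlinarith
        nlinarith [mul_pos this (by nlinarith : 0 < 1 + p ^ 2 - p)]

theorem integral_kernelV :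
    ∫ p in Ioo (0 : ℝ) 1, (1 + p) * kernelV p = 7 * Real.pi ^ 2 / 24 + 2 * catalanG := by
  have h₁ := integral_logPart
  have h₂ := integral_arcPart
  rw [integral_Ioc_eq_integral_Ioo] at h₁ h₂
  have h := integral_add integrableOn_logPart (integrableOn_arcPart.mono_set Ioo_subset_Ioc_self)
  rw [h₁, h₂] at h
  rw [show 7 * Real.pi ^ 2 / 24 + 2 * catalanG
    = 7 * Real.pi ^ 2 / 24 - 2 * catalanG + 4 * catalanG by ring, ← h]
  refine setIntegral_congr_fun measurableSet_Ioo fun p hp => ?_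
  rw [kernelV_of_lt_one hp.1 hp.2, mul_add]

/-- Conservation of the wave action at the level of the kernel. -/
theorem integral_K_mul_exp_half : ∫ x, K x * Real.exp (1 / 2 * x) = -gamma := by
  have hi := integrable_K (σ := 1 / 2) (by norm_num) (by norm_num)
  have hi' := integrable_K (σ := 1) (by norm_num) (by norm_num)
  -- Reflection turns the weight 1/2 on x > 0 into 3/2 - 1/2 = 1 on x < 0.
  have hpos : ∫ x in Ioi 0, K x * Real.exp (1 / 2 * x) = ∫ x in Iic 0, K x * Real.exp (1 * x) := by
    have h := integral_comp_neg_Iic 0 fun x => K x * Real.exp (1 / 2 * x)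
    rw [neg_zero] at h
    rw [← h]
    refine setIntegral_congr_fun measurableSet_Iic fun x _ => ?_
    rw [K_neg, mul_right_comm, ← Real.exp_add, mul_comm]
    ring_nf
  have himg : (fun x : ℝ => Real.exp (x / 2)) '' Iio 0 = Ioo 0 1 := by
    ext p
    constructor
    · rintro ⟨x, hx, rfl⟩
      exact ⟨Real.exp_pos _, Real.exp_lt_one_iff.2 (by linarith [mem_Iio.1 hx])⟩
    · rintro ⟨h₀, h₁⟩
      refine ⟨2 * Real.log p, ?_, ?_⟩
      · have := Real.log_neg h₀ h₁
        exact mem_Iio.2 (by linarith)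
      · simp only
        rw [mul_div_cancel_left₀ _ two_ne_zero, Real.exp_log h₀]
  -- With p = e^{x/2}, (e^{x/2} + e^x) dx = 2(1 + p) dp, which explains the factor 1 + p in
  -- `integral_kernelV`.
  have hcv := integral_image_eq_integral_abs_deriv_smul (s := Iio 0)
    (f := fun x : ℝ => Real.exp (x / 2)) (f' := fun x => Real.exp (x / 2) * (1 / 2))
    measurableSet_Iio
    (fun x _ => ((hasDerivAt_id x).div_const 2).exp.hasDerivWithinAt)
    (fun x _ y _ hxy => by
      have := Real.exp_injective hxy
      linarith)
    (fun p => (1 + p) * kernelV p)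
  rw [himg, integral_kernelV] at hcv
  rw [← intervalIntegral.integral_Iic_add_Ioi hi.integrableOn hi.integrableOn (b := 0), hpos,
    ← integral_add hi.integrableOn hi'.integrableOn, integral_Iic_eq_integral_Iio, gamma, gammaN,
    show -(2 * -(2 * catalanG + 7 * Real.pi ^ 2 / 24))
      = 2 * (7 * Real.pi ^ 2 / 24 + 2 * catalanG) by ring, hcv, ← integral_const_mul]
  refine setIntegral_congr_fun measurableSet_Iio fun x _ => ?_
  simp only [smul_eq_mul, K]
  rw [abs_of_pos (by positivity), show 1 * x = x / 2 + x / 2 by ring, Real.exp_add,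
    show 1 / 2 * x = x / 2 by ring]
  ring

theorem integral_K_mul_exp_one : ∫ x, K x * Real.exp (1 * x) = -gamma := by
  rw [← integral_K_mul_exp_half, ← integral_neg_eq_self]
  refine integral_congr_ae (Filter.Eventually.of_forall fun x => ?_)
  simp only
  rw [K_neg, mul_right_comm, ← Real.exp_add, mul_comm]
  ring_nf

/-- The decay rate `-(γ + K̂(3i/4))` is positive. -/
theorem gamma_add_integral_K_neg : gamma + ∫ x, K x * Real.exp (3 / 4 * x) < 0 := by
  have h₁ := integrable_K (σ := 1 / 2) (by norm_num) (by norm_num)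
  have h₂ := integrable_K (σ := 1) (by norm_num) (by norm_num)
  have h₃ := integrable_K (σ := 3 / 4) (by norm_num) (by norm_num)
  have h₁₂ : Integrable fun x => K x * Real.exp (1 / 2 * x) + K x * Real.exp (1 * x) := h₁.add h₂
  -- The convexity defect at the midpoint 3/4 is a perfect square, vanishing only at x = 0.
  have hsq : ∀ x, K x * Real.exp (1 / 2 * x) + K x * Real.exp (1 * x)
      - 2 * (K x * Real.exp (3 / 4 * x))
      = K x * (Real.exp (1 / 4 * x) - Real.exp (1 / 2 * x)) ^ 2 := fun x => by
    rw [show 1 * x = 1 / 2 * x + 1 / 2 * x by ring, show 3 / 4 * x = 1 / 4 * x + 1 / 2 * x by ring,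
      Real.exp_add, Real.exp_add, show Real.exp (1 / 2 * x) = Real.exp (1 / 4 * x) ^ 2 by
        rw [← Real.exp_nat_mul]; congr 1; push_cast; ring]
    ring
  have hint : ∫ x, K x * (Real.exp (1 / 4 * x) - Real.exp (1 / 2 * x)) ^ 2
      = -gamma + -gamma - 2 * ∫ x, K x * Real.exp (3 / 4 * x) := by
    simp_rw [← hsq]
    rw [integral_sub h₁₂ (h₃.const_mul 2), integral_add h₁ h₂, integral_const_mul,
      integral_K_mul_exp_half, integral_K_mul_exp_one]
  have hI : Integrable fun x => K x * (Real.exp (1 / 4 * x) - Real.exp (1 / 2 * x)) ^ 2 := by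
    simp_rw [← hsq]
    exact h₁₂.sub (h₃.const_mul 2)
  have hpos : 0 < ∫ x, K x * (Real.exp (1 / 4 * x) - Real.exp (1 / 2 * x)) ^ 2 := by
    rw [integral_pos_iff_support_of_nonneg (fun x => mul_nonneg (K_nonneg x) (sq_nonneg _)) hI]
    refine lt_of_lt_of_le ?_ (measure_mono (s := Ioi 0) fun x hx => ?_)
    · simp
    · have hx : 0 < x := hx
      refine (mul_pos (K_pos hx.ne') (sq_pos_of_ne_zero (sub_ne_zero.2 fun h => ?_))).ne'
      have := Real.exp_injective h
      linarith
  linarith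

end KernelIntegral

/-! ### Conclusion -/

section Conclusion

theorem hat_of_im {f : ℝ → ℝ} (σ : ℝ) :
    hat f (((0 : ℝ) : ℂ) + (σ : ℂ) * Complex.I) = ((∫ x, f x * Real.exp (σ * x) : ℝ) : ℂ) := by
  rw [hat_line, ← integral_complex_ofReal]
  simp

theorem Omega_half : Omega (((0 : ℝ) : ℂ) + ((1 / 2 : ℝ) : ℂ) * Complex.I) = 0 := by
  rw [Omega, hat_of_im, integral_K_mul_exp_half]
  simp

theorem integrable_K_zero : Integrable K := by
  simpa using integrable_K (σ := 0) (by norm_num) (by norm_num)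

variable {p : ℝ≥0∞} [Fact (1 ≤ p)] {f₀ : ℝ → ℝ} {f : ℝ → Lp ℝ p (volume : Measure ℝ)} {A B σ t : ℝ}

theorem measurable_K_mul_exp (σ : ℝ) : Measurable fun x => K x * Real.exp (σ * x) :=
  measurable_K.mul (by fun_prop)

theorem IsSolution.memLp_weighted_of_memX (hp : p ≠ ∞) (h : IsSolution p f₀ f)
    (hX : MemX A B f₀) (hσ₀ : -1 < σ) (hσ₁ : σ < 5 / 2) (hA : -A < σ) (hB : σ < -B) {q : ℝ≥0∞}
    [hq1 : Fact (1 ≤ q)] (hq : q ≠ ∞) (ht : 0 ≤ t) :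
    MemLp (fun x => f t x * Real.exp (σ * x)) q :=
  h.memLp_weighted hp measurable_K integrable_K_zero (measurable_K_mul_exp σ)
    (integrable_K hσ₀ hσ₁) hq
    (hX.memLp_weighted hA hB (zero_lt_one.trans_le hq1.out).ne' hq) ht

/-- The total wave action is conserved. -/
theorem IsSolution.integral_eq (hp : p ≠ ∞) (h : IsSolution p f₀ f)
    (h₀ : Integrable fun x => f₀ x * Real.exp (1 / 2 * x)) (ht : 0 ≤ t) :
    ∫ x, f t x * Real.exp (1 / 2 * x) = ∫ x, f₀ x * Real.exp (1 / 2 * x) := by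
  have e := h.hat_eq hp measurable_K integrable_K_zero (measurable_K_mul_exp (1 / 2))
    (integrable_K (by norm_num) (by norm_num)) h₀ ht 0
  rw [Omega_half, hat_of_im, hat_of_im, zero_mul, Complex.exp_zero, mul_one] at e
  exact_mod_cast e

theorem IsSolution.contourIntegrand_eq (hp : p ≠ ∞) (h : IsSolution p f₀ f) (hσ₀ : -1 < σ)
    (hσ₁ : σ < 5 / 2) (h₀ : Integrable fun x => f₀ x * Real.exp (σ * x)) (ht : 0 ≤ t) (L : ℝ) :
    (fun u : ℝ => contourIntegrand f₀ t L ((u : ℂ) + (σ : ℂ) * Complex.I))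
      = fun u : ℝ => hat (f t) ((u : ℂ) + (σ : ℂ) * Complex.I) *
        (Complex.exp ((L : ℂ) * (Complex.I * (u + σ * Complex.I) + 1 / 2))
          / (Complex.I * (u + σ * Complex.I) + 1 / 2)) := by
  funext u
  rw [h.hat_eq hp measurable_K integrable_K_zero (measurable_K_mul_exp σ)
    (integrable_K hσ₀ hσ₁) h₀ ht u, contourIntegrand]

/-- The tail of the wave action is controlled by the `L¹` norm with weight `e^{3x/4}`. -/
theorem abs_setIntegral_Ioi_le {g : ℝ → ℝ} (L : ℝ)
    (hg : Integrable fun x => g x * Real.exp (3 / 4 * x)) :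
    |∫ x in Ioi L, g x * Real.exp (x / 2)|
      ≤ Real.exp (-L / 4) * ∫ x, |g x| * Real.exp (3 / 4 * x) := by
  have habs : Integrable fun x => |g x| * Real.exp (3 / 4 * x) := by
    refine hg.norm.congr (Filter.Eventually.of_forall fun x => ?_)
    simp
  calc |∫ x in Ioi L, g x * Real.exp (x / 2)|
      -- For x > L, e^{x/2} = e^{-x/4} e^{3x/4} ≤ e^{-L/4} e^{3x/4}.
      ≤ ∫ x in Ioi L, Real.exp (-L / 4) * (|g x| * Real.exp (3 / 4 * x)) := by
        rw [← Real.norm_eq_abs]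
        refine norm_integral_le_of_norm_le (habs.const_mul _).integrableOn ?_
        refine (ae_restrict_iff' measurableSet_Ioi).2 (Filter.Eventually.of_forall fun x hx => ?_)
        rw [norm_mul, Real.norm_eq_abs, Real.norm_of_nonneg (Real.exp_pos _).le, mul_left_comm,
          ← Real.exp_add]
        gcongr
        linarith [mem_Ioi.1 hx]
    _ ≤ ∫ x, Real.exp (-L / 4) * (|g x| * Real.exp (3 / 4 * x)) :=
        setIntegral_le_integral (habs.const_mul _)
          (Filter.Eventually.of_forall fun x => by positivity)
    _ = _ := integral_const_mul _ _

end Conclusion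

end RJ

theorem mainTheorem4 :
    ∃ ν : ℝ, 0 < ν ∧
      Integrable (fun x : ℝ => RJ.K x * Real.exp (3 * x / 4)) ∧
      -(ν : ℂ) = (RJ.gamma : ℂ) + RJ.hat RJ.K (3 * Complex.I / 4) ∧
      ∀ L : ℝ, ∃ C : ℝ, 0 < C ∧
        ∀ (A B : ℝ), -5 / 2 < B → B < -3 / 4 → 1 / 2 < A → A < 1 →
        ∀ f₀ : ℝ → ℝ, RJ.MemX A B f₀ →
        ∀ (p : ℝ≥0∞) [Fact (1 ≤ p)], p ≠ ∞ →
          (∃ f : ℝ → Lp ℝ p (volume : Measure ℝ), RJ.IsSolution p f₀ f) ∧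
          ∀ f : ℝ → Lp ℝ p (volume : Measure ℝ), RJ.IsSolution p f₀ f →
          ∀ σ : ℝ, 1 / 2 < σ → σ < -B →
          ∀ t : ℝ, 0 < t →
            -- all integrals are absolutely convergent
            Integrable (fun x : ℝ => f t x * Real.exp (x / 2)) ∧
            Integrable (fun x : ℝ => f₀ x * Real.exp (σ * x)) ∧
            Integrable (fun x : ℝ => RJ.K x * Real.exp (σ * x)) ∧
            Integrable (fun u : ℝ =>
              RJ.contourIntegrand f₀ t L ((u : ℂ) + (σ : ℂ) * Complex.I)) ∧
            Integrable (fun x : ℝ => |f₀ x| * Real.exp (3 * x / 4)) ∧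
            -- the total wave action is conserved
            (∫ x : ℝ, f t x * Real.exp (x / 2)) = ∫ x : ℝ, f₀ x * Real.exp (x / 2) ∧
            -- the representation formula
            ((∫ x in Iic L, f t x * Real.exp (x / 2) : ℝ) : ℂ) =
              ((∫ x : ℝ, f t x * Real.exp (x / 2) : ℝ) : ℂ) +
                1 / (2 * (Real.pi : ℂ)) *
                  ∫ u : ℝ, RJ.contourIntegrand f₀ t L ((u : ℂ) + (σ : ℂ) * Complex.I) ∧
            -- the decay estimate
            ‖∫ u : ℝ, RJ.contourIntegrand f₀ t L ((u : ℂ) + (σ : ℂ) * Complex.I)‖ ≤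
              C * Real.exp (-ν * t) * ∫ x : ℝ, |f₀ x| * Real.exp (3 * x / 4) := by
  have e34 : ∀ x : ℝ, 3 * x / 4 = 3 / 4 * x := fun x => by ring
  have e12 : ∀ x : ℝ, 1 / 2 * x = x / 2 := fun x => by ring
  have hK34 := RJ.integrable_K (σ := 3 / 4) (by norm_num) (by norm_num)
  -- In C, the factor 2π comes from Parseval and e^{-L/4} from the tail bound.
  refine ⟨-(RJ.gamma + ∫ x, RJ.K x * Real.exp (3 / 4 * x)),
    neg_pos.2 RJ.gamma_add_integral_K_neg, ?_, ?_, fun L => ⟨2 * Real.pi * Real.exp (-L / 4),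
      by positivity, fun A B hB₁ hB₂ hA₁ hA₂ f₀ hX p _ hp => ⟨?_, fun f hf σ hσ₁ hσ₂ t ht => ?_⟩⟩⟩
  · simpa only [e34] using hK34
  · have h := RJ.hat_of_im (f := RJ.K) (3 / 4)
    rw [show ((0 : ℝ) : ℂ) + ((3 / 4 : ℝ) : ℂ) * Complex.I = 3 * Complex.I / 4 by
      push_cast; ring] at h
    rw [h]
    push_cast
    ring
  · refine RJ.exists_isSolution hp RJ.measurable_K RJ.integrable_K_zero ?_
    have hp1 : 1 ≤ p := Fact.out
    simpa using hX.memLp_weighted (σ := 0) (by linarith) (by linarith)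
      (zero_lt_one.trans_le hp1).ne' hp
  have hf₀ : ∀ s : ℝ, 0 < s → s < -B → Integrable fun x => f₀ x * Real.exp (s * x) :=
    fun s hs hs' => memLp_one_iff_integrable.1
      (hX.memLp_weighted (by linarith) hs' one_ne_zero ENNReal.one_ne_top)
  have hft : ∀ s : ℝ, 0 < s → s < -B → Integrable fun x => f t x * Real.exp (s * x) :=
    fun s hs hs' => memLp_one_iff_integrable.1
      (hf.memLp_weighted_of_memX hp hX (by linarith) (by linarith) (by linarith) hs'
        ENNReal.one_ne_top ht.le)
  have hft₂ : MemLp (fun x => f t x * Real.exp (σ * x)) 2 :=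
    hf.memLp_weighted_of_memX hp hX (by linarith) (by linarith) (by linarith) hσ₂
      ENNReal.ofNat_ne_top ht.le
  have hσ := hf₀ σ (by linarith) hσ₂
  have hσt := hft σ (by linarith) hσ₂
  have h34 := hf₀ (3 / 4) (by norm_num) (by linarith)
  have h34t := hft (3 / 4) (by norm_num) (by linarith)
  have h12 := hf₀ (1 / 2) (by norm_num) (by linarith)
  have h12t : Integrable fun x => f t x * Real.exp (x / 2) := by
    simpa only [e12] using hft (1 / 2) (by norm_num) (by linarith)
  have hcontour := hf.contourIntegrand_eq hp (σ := σ) (by linarith) (by linarith) hσ ht.le L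
  have hint : ∫ u : ℝ, RJ.contourIntegrand f₀ t L ((u : ℂ) + (σ : ℂ) * Complex.I)
      = -(2 * Real.pi * ((∫ x in Ioi L, f t x * Real.exp (x / 2) : ℝ) : ℂ)) := by
    rw [hcontour]
    exact RJ.integral_contour hσ₁ L hσt hft₂
  refine ⟨h12t, hσ, RJ.integrable_K (by linarith) (by linarith), ?_, ?_, ?_, ?_, ?_⟩
  · rw [hcontour]
    exact RJ.integrable_contour hσ₁ L hσt hft₂
  · refine h34.norm.congr (Filter.Eventually.of_forall fun x => ?_)
    simp [e34]
  · simpa only [e12] using hf.integral_eq hp h12 ht.le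
  · have hpi : (Real.pi : ℂ) ≠ 0 := by exact_mod_cast Real.pi_ne_zero
    rw [hint, ← intervalIntegral.integral_Iic_add_Ioi h12t.integrableOn h12t.integrableOn (b := L)]
    push_cast
    field_simp
    ring
  -- The integral over Im ξ = σ is bounded through the tail it represents, always with the weight
  -- 3/4, so neither ν nor C depends on σ.
  · have htail := RJ.abs_setIntegral_Ioi_le L h34t
    have hdecay := hf.integral_abs_le hp RJ.measurable_K RJ.integrable_K_zero
      (RJ.measurable_K_mul_exp (3 / 4)) hK34 h34 ht.le
    have hKabs : ∀ x, |RJ.K x * Real.exp (3 / 4 * x)| = RJ.K x * Real.exp (3 / 4 * x) := fun x =>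
      abs_of_nonneg (mul_nonneg (RJ.K_nonneg x) (Real.exp_pos _).le)
    simp only [hKabs] at hdecay
    rw [hint, norm_neg, norm_mul, norm_mul, Complex.norm_real, Complex.norm_real,
      Complex.norm_ofNat, Real.norm_of_nonneg Real.pi_pos.le, Real.norm_eq_abs, neg_neg]
    simp only [e34]
    calc 2 * Real.pi * |∫ x in Ioi L, f t x * Real.exp (x / 2)|
        ≤ 2 * Real.pi * (Real.exp (-L / 4) *
          (Real.exp ((RJ.gamma + ∫ x, RJ.K x * Real.exp (3 / 4 * x)) * t)
            * ∫ x, |f₀ x| * Real.exp (3 / 4 * x))) := by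
          gcongr
          exact htail.trans (mul_le_mul_of_nonneg_left hdecay (Real.exp_pos _).le)
      _ = _ := by ring
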